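/- Let $\mathcal A$ be a finite set, $T$ the left shift on $\mathcal A^{\mathbb N}$, $x_1^n=x_1\dotsc x_n$, and $[a]=\{x: x_1^n=a\}$ for $a\in\mathcal A^n$. For $x,y\in\mathcal A^{\mathbb N}$ and $N\in\mathbb N$ put $$W_\ell(y,x)=\inf\{r\ge 1: x_r^{r+\ell-1}=y_1^\ell\},\qquad \Lambda_N(y,x)=\max\{1,\sup\{\ell\ge 1: W_\ell(y,x)\le N-\ell+1\}\}$$ (with $\sup\emptyset=0$), let $L_0=0$ and $L_{i+1}=\min\{N,\,L_i+\Lambda_N(T^{L_i}y,x)+1\}$, let $c_N=c_N(y|x)$ be the least $i$ with $L_i=N$ (the number of words of the modified Ziv--Merhav parsing of $y_1^N$ with respect to $x_1^N$), and for $N\ge 2$ let $$Q_N(y,x)=\frac{c_N\ln N}{N-c_N}.$$ For a shift-invariant Borel probability measure $\mathbb P$ on $\mathcal A^{\mathbb N}$ write $\mathbb P[a]$ for the measure of the cylinder $[a]$, $\operatorname{supp}\mathbb P_n=\{a\in\mathcal A^n:\mathbb P[a]>0\}$ and $\operatorname{supp}\mathbb P=\{x:\mathbb P[x_1^n]>0\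 \text{for all } n\}$. Consider the following conditions. * (UD) There are sequences $k_n\ge 0$ (real) and $\tau_n\in\mathbb N_0$, both $o(n)$, such that $\mathbb P[a\xi b]\le e^{k_n}\mathbb P[a]\mathbb P[b]$ for all $n,m\ge1$, $a\in\operatorname{supp}\mathbb P_n$, $\xi\in\operatorname{supp}\mathbb P_{\tau_n}$, $b\in\operatorname{supp}\mathbb P_m$. * (SLD) There are such sequences for which, for all $n,m\ge1$, $a\in\operatorname{supp}\mathbb P_n$, $b\in\operatorname{supp}\mathbb P_m$, there are $0\le\ell\le\tau_n$ and $\xi\in\operatorname{supp}\mathbb P_\ell$ with $\mathbb P[a\xi b]\ge e^{-k_n}\mathbb P[a]\mathbb P[b]$. * (SE) There are $\beta\ge1$ and $\gamma_-<0$ with $\min_{a\in\operatorname{supp}\mathbb P_n}\mathbb P[a]\ge e^{\gamma_- n^\beta}$ for all $n\ge1$. * (ND), for a pair $(\mathbb P,\mathbb Q)$: $\displaystyle\limsup_{n\to\infty}\frac1n\ln\sum_{a\in\operatorname{supp}\mathbb P_n}\mathbb P[a]\,\mathbb Q[a]<0$. * (WG, weak Gibbs in the sense of Yuri) There are a subshift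 $\Omega'\subseteq\mathcal A^{\mathbb N}$ (closed, $T\Omega'\subseteq\Omega'$) with $\mathbb P(\Omega')=1$, a continuous $\phi:\Omega'\to\mathbb R$, and a nondecreasing sequence $K_n>0$ with $\ln K_n=o(n)$ such that for all $n\ge1$ and $y\in\Omega'$ $$K_n^{-1}e^{\sum_{j=0}^{n-1}\phi(T^jy)-np_{\mathrm{top}}(\phi)}\le\mathbb P[y_1^n]\le K_n e^{\sum_{j=0}^{n-1}\phi(T^jy)-np_{\mathrm{top}}(\phi)},$$ where $p_{\mathrm{top}}(\phi)=\limsup_{n\to\infty}\frac1n\ln\sum_{a\in\mathcal A^n,\ [a]\cap\Omega'\ne\emptyset}\exp\bigl(\sup_{y\in[a]\cap\Omega'}\sum_{j=0}^{n-1}\phi(T^jy)\bigr)$ is the topological pressure of $\phi$. **Corollary 4.4.** Let $\mathbb P$ and $\mathbb Q$ be shift-invariant Borel probability measures on $\mathcal A^{\mathbb N}$ with $\operatorname{supp}\mathbb Q\subseteq\operatorname{supp}\mathbb P$. Suppose that $\mathbb P$ satisfies (SLD), (UD), (SE) and (WG), that $\mathbb Q$ is ergodic and satisfies (UD), and that $(\mathbb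 P,\mathbb Q)$ satisfies (ND). Then the cross entropy $$h_{\mathrm c}(\mathbb Q|\mathbb P)=\lim_{n\to\infty}-\frac1n\sum_{a\in\mathcal A^n}\mathbb Q[a]\ln\mathbb P[a]$$ (with $0\ln 0=0$) exists and is finite, and $$\lim_{N\to\infty}Q_N(y,x)=h_{\mathrm c}(\mathbb Q|\mathbb P)\qquad\text{for }(\mathbb P\otimes\mathbb Q)\text{-almost every }(x,y).$$ -/

import Mathlib

open Filter Topology MeasureTheory Asymptotics

noncomputable section

namespace ZivMerhav

variable {A : Type*}

/-- The left shift on one-sided sequences. The symbol `x_k` of the literature is `x (k - 1)`. -/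
def shift (x : ℕ → A) : ℕ → A := fun n => x (n + 1)

/-- The word `x_1^n` made of the first `n` symbols of `x`. -/
def word (x : ℕ → A) (n : ℕ) : Fin n → A := fun i => x i

/-- The basic cylinder `[a]` of the sequences that start with the word `a`. -/
def cyl {n : ℕ} (a : Fin n → A) : Set (ℕ → A) := {x | word x n = a}

/-- The concatenation `a ξ b` of three words. -/
def concat {n l m : ℕ} (a : Fin n → A) (ξ : Fin l → A) (b : Fin m → A) : Fin (n + l + m) → A :=
  Fin.append (Fin.append a ξ) b

/-! ### The modified Ziv-Merhav parsing and estimator -/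

/-- The waiting time `W_ℓ(y, x) = inf {r ≥ 1 : x_r^{r+ℓ-1} = y_1^ℓ}`, infinite if `y_1^ℓ` does not
occur in `x`. The index `r` below is the one of the literature minus one. -/
def waitingTime (l : ℕ) (y x : ℕ → A) : ℕ∞ :=
  ⨅ (r : ℕ) (_ : word (shift^[r] x) l = word y l), ((r + 1 : ℕ) : ℕ∞)

/-- The match length `Λ_N(y, x) = max {1, sup {ℓ ≥ 1 : W_ℓ(y, x) ≤ N - ℓ + 1}}`. All the `ℓ` in the
set are at most `N`; the supremum of the empty set is `0` here. -/
def matchLength (N : ℕ) (y x : ℕ → A) : ℕ :=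
  max 1 (sSup {l : ℕ | 1 ≤ l ∧ waitingTime l y x + (l : ℕ∞) ≤ (N : ℕ∞) + 1})

/-- `parsedLength N y x i` is the sum `L_i` of the lengths of the first `i` words of the parsing of
`y_1^N` with respect to `x_1^N`: the next word runs from the symbol number `L_i + 1` of `y` to the
symbol number `min {N, L_i + Λ_N(T^{L_i} y, x) + 1}`. -/
def parsedLength (N : ℕ) (y x : ℕ → A) : ℕ → ℕ
  | 0 => 0
  | i + 1 =>
    min N (parsedLength N y x i + matchLength N (shift^[parsedLength N y x i] y) x + 1)

/-- The number `c_N(y|x)` of words in the parsing: the first `i` for which the first `i` words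
exhaust `y_1^N`. -/
def wordCount (N : ℕ) (y x : ℕ → A) : ℕ := sInf {i : ℕ | parsedLength N y x i = N}

/-- The estimator `Q_N(y, x) = c_N ln N / (N - c_N)`. As all the words but the last have at least
two symbols, `c_N < N` as soon as `2 ≤ N`. -/
def estimator (N : ℕ) (y x : ℕ → A) : ℝ :=
  (wordCount N y x : ℝ) * Real.log N / ((N : ℝ) - (wordCount N y x : ℝ))

/-! ### Supports, decoupling and decay -/

section Measures

variable [MeasurableSpace A]

/-- `supp P_n`, the set of the words of length `n` of positive probability. -/
def suppWords (P : Measure (ℕ → A)) (n : ℕ) : Set (Fin n → A) := {a | 0 < P (cyl a)}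

/-- `supp P`, the set of the sequences all of whose prefixes have positive probability. -/
def suppSeq (P : Measure (ℕ → A)) : Set (ℕ → A) := {x | ∀ n : ℕ, 0 < P (cyl (word x n))}

/-- Upper decoupling (UD). -/
def UpperDecoupled (P : Measure (ℕ → A)) : Prop :=
  ∃ (k : ℕ → ℝ) (τ : ℕ → ℕ), (∀ n, 0 ≤ k n) ∧
    (k =o[atTop] fun n : ℕ => (n : ℝ)) ∧
    ((fun n : ℕ => (τ n : ℝ)) =o[atTop] fun n : ℕ => (n : ℝ)) ∧
    ∀ n : ℕ, 1 ≤ n → ∀ a ∈ suppWords P n, ∀ ξ ∈ suppWords P (τ n),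
      ∀ m : ℕ, 1 ≤ m → ∀ b ∈ suppWords P m,
        P.real (cyl (concat a ξ b)) ≤ Real.exp (k n) * (P.real (cyl a) * P.real (cyl b))

/-- Selective lower decoupling (SLD). -/
def SelectivelyLowerDecoupled (P : Measure (ℕ → A)) : Prop :=
  ∃ (k : ℕ → ℝ) (τ : ℕ → ℕ), (∀ n, 0 ≤ k n) ∧
    (k =o[atTop] fun n : ℕ => (n : ℝ)) ∧
    ((fun n : ℕ => (τ n : ℝ)) =o[atTop] fun n : ℕ => (n : ℝ)) ∧
    ∀ n : ℕ, 1 ≤ n → ∀ a ∈ suppWords P n, ∀ m : ℕ, 1 ≤ m → ∀ b ∈ suppWords P m,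
      ∃ l ≤ τ n, ∃ ξ ∈ suppWords P l,
        Real.exp (-k n) * (P.real (cyl a) * P.real (cyl b)) ≤ P.real (cyl (concat a ξ b))

/-- Slow enough decay (SE). -/
def DecaysSlowlyEnough (P : Measure (ℕ → A)) : Prop :=
  ∃ β γ : ℝ, 1 ≤ β ∧ γ < 0 ∧ ∀ n : ℕ, 1 ≤ n → ∀ a ∈ suppWords P n,
    Real.exp (γ * (n : ℝ) ^ β) ≤ P.real (cyl a)

/-! ### Weak Gibbs measures -/

/-- A (one-sided) subshift: a closed set of sequences that is stable under the shift. -/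
def IsSubshift [TopologicalSpace A] (Ω : Set (ℕ → A)) : Prop :=
  IsClosed Ω ∧ Set.MapsTo shift Ω Ω

open Classical in
/-- The topological pressure of `φ` on the subshift `Ω`: the exponential growth rate of the sum, over
the words `a` of length `n` of `Ω`, of `exp (sup {∑_{j<n} φ(T^j y) : y ∈ Ω ∩ [a]})`. -/
def topPressure [Fintype A] (Ω : Set (ℕ → A)) (φ : (ℕ → A) → ℝ) : ℝ :=
  limsup (fun n : ℕ => (1 / (n : ℝ)) *
    Real.log (∑ a : Fin n → A with (Ω ∩ cyl a).Nonempty,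
      Real.exp (sSup (birkhoffSum shift φ n '' (Ω ∩ cyl a))))) atTop

/-- `P` is a weak Gibbs measure on some subshift `Ω` (which carries `P`). Only the restriction of
`φ` to `Ω` matters. -/
def WeakGibbs [Fintype A] [TopologicalSpace A] (P : Measure (ℕ → A)) : Prop :=
  ∃ (Ω : Set (ℕ → A)) (φ : (ℕ → A) → ℝ) (K : ℕ → ℝ),
    IsSubshift Ω ∧ (∀ᵐ x ∂P, x ∈ Ω) ∧ ContinuousOn φ Ω ∧
    Monotone K ∧ (∀ n, 0 < K n) ∧
    ((fun n : ℕ => Real.log (K n)) =o[atTop] fun n : ℕ => (n : ℝ)) ∧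
    ∀ n : ℕ, 1 ≤ n → ∀ y ∈ Ω,
      (K n)⁻¹ * Real.exp (birkhoffSum shift φ n y - n * topPressure Ω φ)
          ≤ P.real (cyl (word y n)) ∧
      P.real (cyl (word y n))
          ≤ K n * Real.exp (birkhoffSum shift φ n y - n * topPressure Ω φ)

/-! ### Cross-entropic pressure and cross entropy -/

open Classical in
/-- The cross-entropic pressure
`q(α) = limsup_n (1/n) ln ∑_{a ∈ supp P_n} P[a]^{-α} Q[a]`, with values in `[-∞, ∞]`. -/
def crossPressure [Fintype A] (P Q : Measure (ℕ → A)) (α : ℝ) : EReal :=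
  ExpGrowth.expGrowthSup fun n : ℕ => ∑ a : Fin n → A with a ∈ suppWords P n,
    P (cyl a) ^ (-α) * Q (cyl a)

/-- Nondegeneracy (ND) of the pair `(P, Q)`. -/
def Nondegenerate [Fintype A] (P Q : Measure (ℕ → A)) : Prop := crossPressure P Q (-1) < 0

/-- `h` is the specific cross entropy of `Q` with respect to `P`, i.e. the limit of
`-(1/n) ∑_{a ∈ A^n} Q[a] ln P[a]` exists and equals `h`. It is meant for `supp Q ⊆ supp P`, in which
case the terms with `P[a] = 0` have `Q[a] = 0` and vanish. -/
def IsCrossEntropy [Fintype A] (Q P : Measure (ℕ → A)) (h : ℝ) : Prop :=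
  Tendsto (fun n : ℕ => -(1 / (n : ℝ)) *
    ∑ a : Fin n → A, Q.real (cyl a) * Real.log (P.real (cyl a))) atTop (𝓝 h)

end Measures

end ZivMerhav

end

/-! The weak Gibbs property makes information additive. The bounded potential `ψ = p_top(φ) - φ` has
Birkhoff sums equal to -ln P[y_1^n] up to an o(n) error that is uniform on the subshift. Integrating
against Q identifies the cross entropy with ∫ψ dQ, and Birkhoff's theorem gives S_Nψ(y)/N → ∫ψ dQ
for Q-almost every y. The parsing splits S_Nψ(y) exactly into the sums along the c_N words, so it is
enough that a typical parsed word carries information close to ln N: then c_N ln N ~ N ∫ψ dQ, hence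
c_N = o(N), and Q_N has the same limit.

For the lower bound on the information of a word: a parsed word, except possibly the last, is a
match prolonged by one symbol and does not occur in x_1^N. Under (SLD), a word of length O(ln N) and
probability at least N^{-(1-ε)} has about N^{1-ε/4} successive chances to appear in x_1^N, so all
such words of y do appear (`SelectivelyLowerDecoupled.ae_eventually_occurs`). A parsed word must
therefore be less likely than that.

For the upper bound: a match does occur, and by a union bound and Markov's inequality words of
probability below N^{-(1+ε)} occur from at most N^{1-ε/2} starting positions in y
(`ae_eventually_exists_exceptional`). Each of these costs only O(ln N), because (ND) bounds all
matches by C ln N (`Nondegenerate.ae_eventually_not_occurs`). -/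

noncomputable section

namespace ZivMerhav

/-! ### Birkhoff's ergodic theorem for bounded functions -/

section Birkhoff

variable {α : Type*}

/-- The largest of the Birkhoff sums `S_0 f, …, S_n f`. -/
def birkhoffMax (T : α → α) (f : α → ℝ) : ℕ → α → ℝ
  | 0 => fun _ => 0
  | n + 1 => fun x => max 0 (f x + birkhoffMax T f n (T x))

variable {T : α → α} {f : α → ℝ}

lemma birkhoffMax_nonneg (n : ℕ) (x : α) : 0 ≤ birkhoffMax T f n x := by
  cases n with
  | zero => exact le_rfl
  | succ n => exact le_max_left _ _

lemma birkhoffMax_le_succ (n : ℕ) (x : α) : birkhoffMax T f n x ≤ birkhoffMax T f (n + 1) x := by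
  induction n generalizing x with
  | zero => exact birkhoffMax_nonneg _ _
  | succ n ih =>
    have := ih (T x)
    simp only [birkhoffMax] at this ⊢
    gcongr

lemma birkhoffMax_mono (x : α) : Monotone fun n => birkhoffMax T f n x :=
  monotone_nat_of_le_succ fun n => birkhoffMax_le_succ n x

lemma birkhoffSum_le_birkhoffMax (n : ℕ) (x : α) :
    birkhoffSum T f n x ≤ birkhoffMax T f n x := by
  induction n generalizing x with
  | zero => simp [birkhoffMax]
  | succ n ih =>
    rw [birkhoffSum_succ']
    exact le_max_of_le_right (by linarith [ih (T x)])

lemma birkhoffMax_le {C : ℝ} (hC : ∀ x, |f x| ≤ C) (n : ℕ) (x : α) :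
    birkhoffMax T f n x ≤ n * C := by
  have hC0 : 0 ≤ C := (abs_nonneg _).trans (hC x)
  induction n generalizing x with
  | zero => simp [birkhoffMax]
  | succ n ih =>
    have h1 := ih (T x)
    have h2 := (abs_le.1 (hC x)).2
    push_cast
    exact max_le (by positivity) (by linarith)

variable [MeasurableSpace α] {μ : Measure α}

lemma measurable_birkhoffMax (hT : Measurable T) (hf : Measurable f) (n : ℕ) :
    Measurable (birkhoffMax T f n) := by
  induction n with
  | zero => exact measurable_const
  | succ n ih => exact measurable_const.max (hf.add (ih.comp hT))

lemma integrable_of_bounded [IsFiniteMeasure μ] (hf : Measurable f) {C : ℝ}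
    (hC : ∀ x, |f x| ≤ C) : Integrable f μ :=
  Integrable.of_bound hf.aestronglyMeasurable C (Eventually.of_forall hC)

lemma integral_comp_eq (hT : MeasurePreserving T μ μ) (hf : Measurable f) :
    ∫ x, f (T x) ∂μ = ∫ x, f x ∂μ := by
  have := integral_map (μ := μ) hT.measurable.aemeasurable hf.aestronglyMeasurable
  rw [hT.map_eq] at this
  exact this.symm

/-- Garsia's argument. Boundedness of the maxima M_n is a T-invariant event, so otherwise M_n ∘ T →
∞ almost everywhere. Then M_{n+1} - M_n ∘ T = max(-M_n ∘ T, f) tends to f, while its integral is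
∫(M_{n+1} - M_n) ≥ 0, which contradicts ∫f < 0. -/
lemma ae_bddAbove_birkhoffMax [IsProbabilityMeasure μ] (hT : Ergodic T μ) (hf : Measurable f)
    {C : ℝ} (hC : ∀ x, |f x| ≤ C) (hneg : ∫ x, f x ∂μ < 0) :
    ∀ᵐ x ∂μ, BddAbove (Set.range fun n => birkhoffMax T f n x) := by
  have hTm := hT.toMeasurePreserving.measurable
  have hmeas := measurable_birkhoffMax hTm hf
  set s : Set α := {x | BddAbove (Set.range fun n => birkhoffMax T f n x)} with hs
  have hsm : MeasurableSet s := by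
    have : s = ⋃ B : ℕ, ⋂ n, {x | birkhoffMax T f n x ≤ B} := by
      ext x
      simp only [hs, Set.mem_ofPred_eq, Set.mem_iUnion, Set.mem_iInter]
      constructor
      · rintro ⟨b, hb⟩
        obtain ⟨B, hB⟩ := exists_nat_ge b
        exact ⟨B, fun n => (hb ⟨n, rfl⟩).trans hB⟩
      · rintro ⟨B, hB⟩
        exact ⟨B, by rintro _ ⟨n, rfl⟩; exact hB n⟩
    rw [this]
    exact .iUnion fun B => .iInter fun n => measurableSet_le (hmeas n) measurable_const
  have hinv : T ⁻¹' s = s := by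
    ext x
    have hx := abs_le.1 (hC x)
    constructor
    · rintro ⟨b, hb⟩
      refine ⟨max 0 (C + b), ?_⟩
      rintro _ ⟨n, rfl⟩
      cases n with
      | zero => exact le_max_left _ _
      | succ n => exact max_le_max le_rfl (add_le_add hx.2 (hb ⟨n, rfl⟩))
    · rintro ⟨b, hb⟩
      refine ⟨C + b, ?_⟩
      rintro _ ⟨n, rfl⟩
      have h1 := hb ⟨n + 1, rfl⟩
      have h2 : f x + birkhoffMax T f n (T x) ≤ birkhoffMax T f (n + 1) x := le_max_right _ _
      simp only at h1 ⊢
      linarith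
  rcases hT.toPreErgodic.ae_mem_or_ae_notMem hsm hinv with h | h
  · exact h
  exfalso
  set g : ℕ → α → ℝ := fun n x => birkhoffMax T f (n + 1) x - birkhoffMax T f n (T x) with hg
  have hg_eq : ∀ n x, g n x = max (-birkhoffMax T f n (T x)) (f x) := by
    intro n x
    simp only [hg, birkhoffMax]
    rw [max_sub_sub_right _ _ _ |>.symm]
    simp
  have hint : ∀ n, Integrable (birkhoffMax T f n) μ := fun n =>
    integrable_of_bounded (hmeas n) (C := n * C) fun x => by
      rw [abs_of_nonneg (birkhoffMax_nonneg n x)]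
      exact birkhoffMax_le hC n x
  have hg_nonneg : ∀ n, 0 ≤ ∫ x, g n x ∂μ := by
    intro n
    have h1 : ∫ x, birkhoffMax T f n (T x) ∂μ = ∫ x, birkhoffMax T f n x ∂μ :=
      integral_comp_eq hT.toMeasurePreserving (hmeas n)
    have h2 : Integrable (fun x => birkhoffMax T f n (T x)) μ :=
      hT.toMeasurePreserving.integrable_comp_of_integrable (hint n)
    change 0 ≤ ∫ x, (birkhoffMax T f (n + 1) x - birkhoffMax T f n (T x)) ∂μ
    rw [integral_sub (hint _) h2, h1, ← integral_sub (hint _) (hint _)]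
    exact integral_nonneg fun x => sub_nonneg.2 (birkhoffMax_le_succ n x)
  have hlim : Tendsto (fun n => ∫ x, g n x ∂μ) atTop (𝓝 (∫ x, f x ∂μ)) := by
    refine tendsto_integral_of_dominated_convergence (fun _ => C)
      (fun n => ((hmeas _).sub ((hmeas n).comp hTm)).aestronglyMeasurable)
      (integrable_const C) (fun n => Eventually.of_forall fun x => ?_) ?_
    · rw [hg_eq, Real.norm_eq_abs]
      have hx := abs_le.1 (hC x)
      have := birkhoffMax_nonneg (T := T) (f := f) n (T x)
      exact abs_le.2 ⟨le_max_of_le_right hx.1, max_le (by linarith) hx.2⟩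
    · filter_upwards [h] with x hx
      have hx' : T x ∉ s := by
        rw [← hinv] at hx
        exact hx
      have htop := tendsto_atTop_of_monotone (birkhoffMax_mono (T := T) (f := f) (T x))
      rcases htop with htop | ⟨l, hl⟩
      · refine tendsto_const_nhds.congr' ?_
        filter_upwards [htop.eventually_ge_atTop (-f x)] with n hn
        rw [hg_eq, max_eq_right (by linarith)]
      · exact absurd hl.bddAbove_range hx'
  exact absurd (ge_of_tendsto' hlim hg_nonneg) (not_le.2 hneg)

/-- The function f - (∫f + ε/2) has negative integral, so its Birkhoff sums are bounded above; the
bound is absorbed by nε/2. -/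
lemma ae_eventually_birkhoffSum_le [IsProbabilityMeasure μ] (hT : Ergodic T μ) (hf : Measurable f)
    {C : ℝ} (hC : ∀ x, |f x| ≤ C) {ε : ℝ} (hε : 0 < ε) :
    ∀ᵐ x ∂μ, ∀ᶠ n : ℕ in atTop, birkhoffSum T f n x / n ≤ ∫ x, f x ∂μ + ε := by
  set I := ∫ x, f x ∂μ with hI
  have hint : ∫ x, (f x - (I + ε / 2)) ∂μ < 0 := by
    rw [integral_sub (integrable_of_bounded hf hC) (integrable_const _)]
    simp [← hI, hε]
  have hbd : ∀ x, |f x - (I + ε / 2)| ≤ C + |I + ε / 2| := fun x =>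
    (abs_sub _ _).trans (by gcongr; exact hC x)
  filter_upwards [ae_bddAbove_birkhoffMax hT (hf.sub_const (I + ε / 2)) hbd hint] with x ⟨B, hB⟩
  filter_upwards [tendsto_natCast_atTop_atTop.eventually_ge_atTop (B / (ε / 2)),
    eventually_gt_atTop 0] with n hn hn0
  have h1 := (birkhoffSum_le_birkhoffMax n x).trans (hB ⟨n, rfl⟩)
  have h2 : birkhoffSum T (fun x => f x - (I + ε / 2)) n x
      = birkhoffSum T f n x - n * (I + ε / 2) := by
    simp [birkhoffSum, Finset.sum_sub_distrib, mul_add]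
  have hn0' : (0 : ℝ) < n := by exact_mod_cast hn0
  rw [div_le_iff₀ (by positivity)] at hn
  rw [div_le_iff₀ hn0']
  nlinarith

/-- Birkhoff's ergodic theorem for a bounded observable of an ergodic system. -/
theorem ae_tendsto_birkhoffSum_div [IsProbabilityMeasure μ] (hT : Ergodic T μ) (hf : Measurable f)
    {C : ℝ} (hC : ∀ x, |f x| ≤ C) :
    ∀ᵐ x ∂μ, Tendsto (fun n : ℕ => birkhoffSum T f n x / n) atTop (𝓝 (∫ x, f x ∂μ)) := by
  have h1 : ∀ᵐ x ∂μ, ∀ m : ℕ, ∀ᶠ n : ℕ in atTop,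
      birkhoffSum T f n x / n ≤ ∫ x, f x ∂μ + 1 / ((m : ℝ) + 1) :=
    ae_all_iff.2 fun m => ae_eventually_birkhoffSum_le hT hf hC Nat.one_div_pos_of_nat
  have h2 : ∀ᵐ x ∂μ, ∀ m : ℕ, ∀ᶠ n : ℕ in atTop,
      birkhoffSum T (fun x => -f x) n x / n ≤ ∫ x, -f x ∂μ + 1 / ((m : ℝ) + 1) :=
    ae_all_iff.2 fun m => ae_eventually_birkhoffSum_le hT hf.neg (by simpa using hC)
      Nat.one_div_pos_of_nat
  filter_upwards [h1, h2] with x h1 h2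
  refine Metric.tendsto_nhds.2 fun ε hε => ?_
  obtain ⟨m, hm⟩ := exists_nat_one_div_lt hε
  filter_upwards [h1 m, h2 m] with n h1 h2
  have h3 : birkhoffSum T (fun x => -f x) n x = -birkhoffSum T f n x := by simp [birkhoffSum]
  rw [h3, neg_div, integral_neg] at h2
  rw [Real.dist_eq, abs_lt]
  constructor <;> linarith

end Birkhoff

/-! ### Combinatorics of the parsing -/

section Parsing

variable {A : Type*}

lemma iterate_shift_apply (r : ℕ) (x : ℕ → A) (n : ℕ) : shift^[r] x n = x (n + r) := by
  induction r generalizing x with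
  | zero => rfl
  | succ r ih =>
    rw [Function.iterate_succ_apply, ih]
    simp only [shift]
    congr 1

lemma word_eq_word_iff {x z : ℕ → A} {l : ℕ} : word x l = word z l ↔ ∀ i < l, x i = z i :=
  ⟨fun h i hi => congrFun h ⟨i, hi⟩, fun h => funext fun i => h i i.2⟩

/-- The word `z_1^l` occurs in `x_1^N`. -/
def Occurs (N : ℕ) (x z : ℕ → A) (l : ℕ) : Prop :=
  ∃ r, r + l ≤ N ∧ word (shift^[r] x) l = word z l

lemma occurs_iff {N : ℕ} {x z : ℕ → A} {l : ℕ} :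
    Occurs N x z l ↔ ∃ r, r + l ≤ N ∧ ∀ i < l, x (i + r) = z i := by
  simp only [Occurs, word_eq_word_iff, iterate_shift_apply]

lemma Occurs.mono {N N' : ℕ} {x z : ℕ → A} {l l' : ℕ} (h : Occurs N x z l) (hN : N ≤ N')
    (hl : l' ≤ l) : Occurs N' x z l' := by
  rw [occurs_iff] at h ⊢
  obtain ⟨r, hr, h⟩ := h
  exact ⟨r, by omega, fun i hi => h i (by omega)⟩

lemma waitingTime_add_le_iff {N : ℕ} {x z : ℕ → A} {l : ℕ} :
    waitingTime l z x + (l : ℕ∞) ≤ (N : ℕ∞) + 1 ↔ Occurs N x z l := by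
  constructor
  · intro h
    have hfin : waitingTime l z x ≠ ⊤ := by
      intro htop
      rw [htop, top_add, top_le_iff] at h
      exact absurd h (by exact_mod_cast ENat.natCast_ne_top (N + 1))
    obtain ⟨w, hw⟩ := ENat.ne_top_iff_exists.1 hfin
    have hlt : waitingTime l z x < ((w + 1 : ℕ) : ℕ∞) := by
      rw [← hw]
      exact_mod_cast Nat.lt_succ_self w
    simp only [waitingTime, iInf_lt_iff] at hlt
    obtain ⟨r, hr, hrw⟩ := hlt
    rw [← hw] at h
    have h1 : r + 1 < w + 1 := by exact_mod_cast hrw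
    have h2 : w + l ≤ N + 1 := by exact_mod_cast h
    exact ⟨r, by omega, hr⟩
  · rintro ⟨r, hr, h⟩
    have h1 : waitingTime l z x ≤ ((r + 1 : ℕ) : ℕ∞) := iInf₂_le r h
    calc waitingTime l z x + (l : ℕ∞) ≤ ((r + 1 : ℕ) : ℕ∞) + (l : ℕ∞) := by gcongr
      _ ≤ (N : ℕ∞) + 1 := by exact_mod_cast (by omega : r + 1 + l ≤ N + 1)

lemma matchLength_eq (N : ℕ) (z x : ℕ → A) :
    matchLength N z x = max 1 (sSup {l : ℕ | 1 ≤ l ∧ Occurs N x z l}) := by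
  simp only [matchLength, waitingTime_add_le_iff]

lemma bddAbove_setOf_occurs (N : ℕ) (z x : ℕ → A) :
    BddAbove {l : ℕ | 1 ≤ l ∧ Occurs N x z l} :=
  ⟨N, fun l hl => by obtain ⟨-, r, hr, -⟩ := hl; omega⟩

lemma one_le_matchLength (N : ℕ) (z x : ℕ → A) : 1 ≤ matchLength N z x := le_max_left _ _

/-- Maximality of the match, which survives the default value 1 because that value still dominates
the supremum. -/
lemma not_occurs_matchLength_succ (N : ℕ) (z x : ℕ → A) :
    ¬ Occurs N x z (matchLength N z x + 1) := by
  intro h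
  have h1 := le_csSup (bddAbove_setOf_occurs N z x) ⟨Nat.le_add_left _ _, h⟩
  have h2 : sSup {l : ℕ | 1 ≤ l ∧ Occurs N x z l} ≤ matchLength N z x := by
    rw [matchLength_eq]; exact le_max_right _ _
  omega

/-- The first alternative covers the default value: a first symbol that is absent from `x_1^N`
counts as a match of length 1. -/
lemma matchLength_eq_one_or_occurs (N : ℕ) (z x : ℕ → A) :
    matchLength N z x = 1 ∨ Occurs N x z (matchLength N z x) := by
  rw [matchLength_eq]
  set s := {l : ℕ | 1 ≤ l ∧ Occurs N x z l} with hs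
  rcases s.eq_empty_or_nonempty with h | h
  · left; simp [h]
  · right
    have hmem := Nat.sSup_mem h (bddAbove_setOf_occurs N z x)
    rw [max_eq_right hmem.1]
    exact hmem.2

lemma matchLength_le_of_not_occurs {N R : ℕ} {z x : ℕ → A} (hR : 1 ≤ R)
    (h : ¬ Occurs N x z R) : matchLength N z x ≤ R := by
  rcases matchLength_eq_one_or_occurs N z x with h1 | h1
  · omega
  · by_contra hlt
    exact h (h1.mono le_rfl (by omega))

/-! ### Successive words of the parsing -/

lemma parsedLength_succ (N : ℕ) (y x : ℕ → A) (i : ℕ) : parsedLength N y x (i + 1) =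
    min N (parsedLength N y x i + matchLength N (shift^[parsedLength N y x i] y) x + 1) := rfl

lemma parsedLength_le (N : ℕ) (y x : ℕ → A) (i : ℕ) : parsedLength N y x i ≤ N := by
  cases i with
  | zero => exact Nat.zero_le _
  | succ i => exact min_le_left _ _

lemma parsedLength_mono (N : ℕ) (y x : ℕ → A) : Monotone (parsedLength N y x) :=
  monotone_nat_of_le_succ fun i => by
    rw [parsedLength_succ]
    exact le_min (parsedLength_le N y x i) (by omega)

lemma exists_parsedLength_eq (N : ℕ) (y x : ℕ → A) : ∃ i, parsedLength N y x i = N := by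
  have h : ∀ i, min N i ≤ parsedLength N y x i := by
    intro i
    induction i with
    | zero => simp
    | succ i ih =>
      rw [parsedLength_succ]
      omega
  exact ⟨N, le_antisymm (parsedLength_le N y x N) (by simpa using h N)⟩

lemma parsedLength_wordCount (N : ℕ) (y x : ℕ → A) :
    parsedLength N y x (wordCount N y x) = N :=
  Nat.sInf_mem (exists_parsedLength_eq N y x)

lemma parsedLength_lt {N : ℕ} {y x : ℕ → A} {i : ℕ} (hi : i < wordCount N y x) :
    parsedLength N y x i < N :=
  lt_of_le_of_ne (parsedLength_le N y x i) fun h =>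
    absurd (Nat.sInf_le (s := {i | parsedLength N y x i = N}) h) (not_le.2 hi)

lemma parsedLength_lt_succ {N : ℕ} {y x : ℕ → A} {i : ℕ} (hi : i < wordCount N y x) :
    parsedLength N y x i < parsedLength N y x (i + 1) := by
  rw [parsedLength_succ]
  exact lt_min (parsedLength_lt hi) (by omega)

lemma parsedLength_succ_of_lt {N : ℕ} {y x : ℕ → A} {i : ℕ} (hi : i + 1 < wordCount N y x) :
    parsedLength N y x (i + 1) =
      parsedLength N y x i + matchLength N (shift^[parsedLength N y x i] y) x + 1 := by
  have h := parsedLength_lt hi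
  rw [parsedLength_succ] at h ⊢
  omega

/-- Distinct words start at distinct positions, so a set of bad positions spoils at most as many
words as it has elements. -/
lemma parsedLength_injOn (N : ℕ) (y x : ℕ → A) :
    Set.InjOn (parsedLength N y x) (Finset.range (wordCount N y x)) := by
  have key : ∀ i j, i < j → i < wordCount N y x → parsedLength N y x i < parsedLength N y x j :=
    fun i j hij hi => (parsedLength_lt_succ hi).trans_le (parsedLength_mono N y x hij)
  intro i hi j hj h
  simp only [Finset.coe_range, Set.mem_Iio] at hi hj
  rcases lt_trichotomy i j with hij | hij | hij
  · exact absurd h (key i j hij hi).ne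
  · exact hij
  · exact absurd h (key j i hij hj).ne'

/-- The cocycle identity, telescoped along the parsing. This exact additivity is what -ln P[·]
itself lacks. -/
lemma birkhoffSum_parsedLength (ψ : (ℕ → A) → ℝ) (N : ℕ) (y x : ℕ → A) :
    birkhoffSum shift ψ N y = ∑ i ∈ Finset.range (wordCount N y x),
      birkhoffSum shift ψ (parsedLength N y x (i + 1) - parsedLength N y x i)
        (shift^[parsedLength N y x i] y) := by
  have h : ∀ i, birkhoffSum shift ψ (parsedLength N y x i) y = ∑ j ∈ Finset.range i,
      birkhoffSum shift ψ (parsedLength N y x (j + 1) - parsedLength N y x j)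
        (shift^[parsedLength N y x j] y) := by
    intro i
    induction i with
    | zero => simp [parsedLength]
    | succ i ih =>
      rw [Finset.sum_range_succ, ← ih, ← birkhoffSum_add,
        Nat.add_sub_cancel' (parsedLength_mono N y x (Nat.le_succ i))]
  rw [← h, parsedLength_wordCount]

lemma sum_parsedLength_sub (N : ℕ) (y x : ℕ → A) :
    ∑ i ∈ Finset.range (wordCount N y x),
      ((parsedLength N y x (i + 1) - parsedLength N y x i : ℕ) : ℝ) = N := by
  have h := birkhoffSum_parsedLength (fun _ => (1 : ℝ)) N y x
  simpa [birkhoffSum] using h.symm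

/-- If a Birkhoff sum is essentially at least `a` along the words which do not occur in `x_1^N`,
and essentially nonnegative along all words, the number of parsed words is bounded from above. -/
lemma wordCount_mul_le {ψ : (ℕ → A) → ℝ} {N : ℕ} {y x : ℕ → A} {a δ D : ℝ} (ha : 0 ≤ a)
    (h0 : ∀ k < N, ∀ n, 1 ≤ n → 0 ≤ birkhoffSum shift ψ n (shift^[k] y) + δ * n + D)
    (h1 : ∀ k < N, a ≤ birkhoffSum shift ψ (matchLength N (shift^[k] y) x + 1) (shift^[k] y)
      + δ * (matchLength N (shift^[k] y) x + 1 : ℕ) + D) :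
    ((wordCount N y x : ℝ) - 1) * a ≤ birkhoffSum shift ψ N y + δ * N + D * wordCount N y x := by
  -- The last word may be truncated at N and then may well occur in `x_1^N`, so only the bound 0 is
  -- available for it; this is the source of the `- 1` in the conclusion.
  have key : ∀ i ∈ Finset.range (wordCount N y x),
      (if i + 1 < wordCount N y x then a else 0) ≤
      birkhoffSum shift ψ (parsedLength N y x (i + 1) - parsedLength N y x i)
        (shift^[parsedLength N y x i] y)
        + δ * ((parsedLength N y x (i + 1) - parsedLength N y x i : ℕ) : ℝ) + D := by
    intro i hi
    rw [Finset.mem_range] at hi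
    split_ifs with hlt
    · have h := h1 _ (parsedLength_lt hi)
      rw [parsedLength_succ_of_lt hlt, Nat.add_assoc, Nat.add_sub_cancel_left]
      exact h
    · have := parsedLength_lt_succ hi
      exact h0 _ (parsedLength_lt hi) _ (by omega)
  have hsum := Finset.sum_le_sum key
  rw [Finset.sum_add_distrib, Finset.sum_add_distrib, ← birkhoffSum_parsedLength,
    ← Finset.mul_sum, sum_parsedLength_sub] at hsum
  have hleft : ((wordCount N y x : ℝ) - 1) * a ≤ ∑ i ∈ Finset.range (wordCount N y x),
      (if i + 1 < wordCount N y x then a else 0) := by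
    rcases Nat.eq_zero_or_pos (wordCount N y x) with h | h
    · simp [h, ha]
    · obtain ⟨m, hm⟩ := Nat.exists_eq_succ_of_ne_zero h.ne'
      rw [hm, Finset.sum_range_succ]
      simp only [Nat.succ_eq_add_one, lt_self_iff_false, if_false, add_zero]
      rw [Finset.sum_congr rfl (g := fun _ => a) fun i hi => by
        rw [if_pos (by have := Finset.mem_range.1 hi; omega)]]
      simp
  simp only [Finset.sum_const, Finset.card_range, nsmul_eq_mul] at hsum
  linarith

open Classical in
/-- If a Birkhoff sum is essentially at most `b` along the matched words outside of a set `B` of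
starting positions, and at most `b'` along all of them, the number of parsed words is bounded from
below. -/
lemma birkhoffSum_le_wordCount_mul {ψ : (ℕ → A) → ℝ} {N : ℕ} {y x : ℕ → A} {b b' δ : ℝ}
    (hb : 0 ≤ b) (hb' : 0 ≤ b') (B : Finset ℕ)
    (h0 : ∀ k < N, ∀ n, 1 ≤ n → n ≤ matchLength N (shift^[k] y) x + 1 →
      birkhoffSum shift ψ n (shift^[k] y) ≤ b' + δ * n)
    (h1 : ∀ k < N, k ∉ B → ∀ n, 1 ≤ n → n ≤ matchLength N (shift^[k] y) x + 1 →
      birkhoffSum shift ψ n (shift^[k] y) ≤ b + δ * n) :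
    birkhoffSum shift ψ N y ≤ wordCount N y x * b + B.card * b' + δ * N := by
  have key : ∀ i ∈ Finset.range (wordCount N y x),
      birkhoffSum shift ψ (parsedLength N y x (i + 1) - parsedLength N y x i)
        (shift^[parsedLength N y x i] y) ≤
      b + (if parsedLength N y x i ∈ B then b' else 0)
        + δ * ((parsedLength N y x (i + 1) - parsedLength N y x i : ℕ) : ℝ) := by
    intro i hi
    rw [Finset.mem_range] at hi
    have hlt := parsedLength_lt_succ hi
    have hle : parsedLength N y x (i + 1) - parsedLength N y x i ≤
        matchLength N (shift^[parsedLength N y x i] y) x + 1 := by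
      rw [parsedLength_succ]
      omega
    split_ifs with hB
    · linarith [h0 _ (parsedLength_lt hi) _ (by omega) hle]
    · linarith [h1 _ (parsedLength_lt hi) hB _ (by omega) hle]
  have hsum := Finset.sum_le_sum key
  rw [Finset.sum_add_distrib, Finset.sum_add_distrib, ← birkhoffSum_parsedLength,
    ← Finset.mul_sum, sum_parsedLength_sub, ← Finset.sum_filter] at hsum
  have hcard : ((Finset.range (wordCount N y x)).filter
      (fun i => parsedLength N y x i ∈ B)).card ≤ B.card :=
    Finset.card_le_card_of_injOn (parsedLength N y x) (fun i hi => (Finset.mem_filter.1 hi).2)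
      ((parsedLength_injOn N y x).mono (by
        intro i hi
        exact (Finset.mem_filter.1 (Finset.mem_coe.1 hi)).1))
  have hcard' : (((Finset.range (wordCount N y x)).filter
      (fun i => parsedLength N y x i ∈ B)).card : ℝ) * b' ≤ B.card * b' := by
    gcongr
  simp only [Finset.sum_const, Finset.card_range, nsmul_eq_mul] at hsum
  linarith

/-! ### Measurability of the estimator -/

lemma matchLength_congr {N : ℕ} {z z' x x' : ℕ → A} (hz : ∀ i < N, z i = z' i)
    (hx : ∀ i < N, x i = x' i) : matchLength N z x = matchLength N z' x' := by
  have h : ∀ l, Occurs N x z l ↔ Occurs N x' z' l := fun l => by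
    simp only [occurs_iff]
    refine exists_congr fun r => and_congr_right fun hr => forall₂_congr fun i hi => ?_
    rw [hz i (by omega), hx (i + r) (by omega)]
  simp only [matchLength_eq, h]

/-- A match sought from a position at most N reads at most N further symbols of `y`, whence the 2N.
-/
lemma parsedLength_congr {N : ℕ} {y y' x x' : ℕ → A} (hy : ∀ i < 2 * N, y i = y' i)
    (hx : ∀ i < N, x i = x' i) (i : ℕ) : parsedLength N y x i = parsedLength N y' x' i := by
  induction i with
  | zero => rfl
  | succ i ih =>
    rw [parsedLength_succ, parsedLength_succ, ← ih]
    have hle := parsedLength_le N y x i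
    rw [matchLength_congr (z' := shift^[parsedLength N y x i] y') (fun j hj => ?_) hx]
    rw [iterate_shift_apply, iterate_shift_apply]
    exact hy _ (by omega)

lemma estimator_congr {N : ℕ} {y y' x x' : ℕ → A} (hy : ∀ i < 2 * N, y i = y' i)
    (hx : ∀ i < N, x i = x' i) : estimator N y x = estimator N y' x' := by
  simp only [estimator, wordCount, parsedLength_congr hy hx]

lemma measurable_word [MeasurableSpace A] (n : ℕ) :
    Measurable (fun x : ℕ → A => word x n) :=
  measurable_pi_lambda _ fun i => measurable_pi_apply (i : ℕ)

lemma measurable_estimator [Fintype A] [MeasurableSpace A] [MeasurableSingletonClass A] (N : ℕ) :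
    Measurable fun xy : (ℕ → A) × (ℕ → A) => estimator N xy.2 xy.1 := by
  rcases isEmpty_or_nonempty A with hA | ⟨⟨a⟩⟩
  · exact measurable_of_empty _
  let ext : ∀ n, (Fin n → A) → ℕ → A := fun n w i => if h : i < n then w ⟨i, h⟩ else a
  have h : (fun xy : (ℕ → A) × (ℕ → A) => estimator N xy.2 xy.1) =
      (fun w : (Fin N → A) × (Fin (2 * N) → A) => estimator N (ext _ w.2) (ext _ w.1)) ∘
        fun xy => (word xy.1 N, word xy.2 (2 * N)) := by
    funext xy
    exact estimator_congr (fun i hi => by simp [ext, hi, word]) fun i hi => by simp [ext, hi, word]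
  rw [h]
  exact (measurable_of_countable _).comp
    (((measurable_word N).comp measurable_fst).prodMk ((measurable_word _).comp measurable_snd))

end Parsing

/-! ### Probabilities of occurrences -/

section Probability

variable {A : Type*}

lemma word_eq_of_mem_cyl_concat {n l m : ℕ} {a : Fin n → A} {ξ : Fin l → A} {b : Fin m → A}
    {w : ℕ → A} (hw : w ∈ cyl (concat a ξ b)) :
    word w n = a ∧ word (shift^[n + l] w) m = b := by
  have hw' : word w (n + l + m) = concat a ξ b := hw
  constructor
  · funext i
    have := congrFun hw' (Fin.castAdd m (Fin.castAdd l i))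
    simpa [concat, word] using this
  · funext i
    have := congrFun hw' (Fin.natAdd (n + l) i)
    simp only [concat, Fin.append_right] at this
    rw [← this]
    simp [word, iterate_shift_apply, add_comm]

variable [MeasurableSpace A]

lemma measurable_iterate_shift (r : ℕ) : Measurable (shift^[r] : (ℕ → A) → ℕ → A) :=
  Measurable.iterate (measurable_pi_lambda _ fun n => measurable_pi_apply (n + 1)) r

variable [MeasurableSingletonClass A]

lemma measurableSet_cyl {n : ℕ} (a : Fin n → A) : MeasurableSet (cyl a) :=
  measurable_word n (measurableSet_singleton a)

lemma measurableSet_setOf_occurs (N : ℕ) (z : ℕ → A) (l : ℕ) :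
    MeasurableSet {x | Occurs N x z l} := by
  have h : {x | Occurs N x z l} = ⋃ r, ⋃ (_ : r + l ≤ N), shift^[r] ⁻¹' cyl (word z l) := by
    ext x
    simp [Occurs, cyl]
  rw [h]
  exact .iUnion fun r => .iUnion fun _ => measurable_iterate_shift r (measurableSet_cyl _)

variable {P Q : Measure (ℕ → A)}

lemma measure_preimage_iterate_shift (hP : MeasurePreserving shift P P) (r : ℕ) {n : ℕ}
    (a : Fin n → A) : P (shift^[r] ⁻¹' cyl a) = P (cyl a) :=
  (hP.iterate r).measure_preimage (measurableSet_cyl a).nullMeasurableSet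

/-- Unlikely prefixes of a given sequence are unlikely to occur. -/
lemma measure_exists_occurs_le [IsProbabilityMeasure P] (hP : MeasurePreserving shift P P)
    (z : ℕ → A) (θ : ℝ) (R : ℕ) :
    P {x | ∃ n, P.real (cyl (word z n)) < θ ∧ Occurs R x z n} ≤ ENNReal.ofReal ((R + 1) * θ) := by
  classical
  by_cases hex : ∃ n, P.real (cyl (word z n)) < θ
  · have hsub : {x | ∃ n, P.real (cyl (word z n)) < θ ∧ Occurs R x z n} ⊆
        -- Every unlikely prefix extends the shortest one, so the union runs over positions only and
        -- not over lengths.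
        ⋃ r ∈ Finset.range (R + 1), shift^[r] ⁻¹' cyl (word z (Nat.find hex)) := by
      rintro x ⟨n, hn, hocc⟩
      obtain ⟨r, hr, h⟩ := hocc.mono le_rfl (Nat.find_min' hex hn)
      simp only [Set.mem_iUnion, Finset.mem_range]
      exact ⟨r, by omega, h⟩
    refine (measure_mono hsub).trans ((measure_biUnion_finset_le _ _).trans ?_)
    simp only [measure_preimage_iterate_shift hP, Finset.sum_const, Finset.card_range,
      nsmul_eq_mul]
    rw [← ofReal_measureReal, ← ENNReal.ofReal_natCast, ← ENNReal.ofReal_mul (by positivity)]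
    refine ENNReal.ofReal_le_ofReal ?_
    push_cast
    have := (Nat.find_spec hex).le
    gcongr
  · have : {x | ∃ n, P.real (cyl (word z n)) < θ ∧ Occurs R x z n} = ∅ := by
      ext x
      simp only [Set.mem_ofPred_eq, Set.mem_empty_iff_false, iff_false]
      rintro ⟨n, hn, -⟩
      exact hex ⟨n, hn⟩
    rw [this]
    simp

variable [Fintype A]

/-- A miss in the long window is a miss in its last m symbols and in its first n + t. Given that the
last m symbols spell `b`, decoupling places the word before `b` with conditional probability at
least q, which makes it occur in the first n + t symbols. -/
lemma measureReal_not_occurs_add_le [IsProbabilityMeasure P] (hP : MeasurePreserving shift P P)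
    {z : ℕ → A} {n t m : ℕ} {q : ℝ}
    (hq : ∀ b ∈ suppWords P m, ∃ l ≤ t, ∃ ξ : Fin l → A,
      q * P.real (cyl b) ≤ P.real (cyl (concat (word z n) ξ b))) :
    P.real {x | ¬ Occurs (n + t + m) x z n} ≤ (1 - q) * P.real {x | ¬ Occurs m x z n} := by
  classical
  set U : ℕ → Set (ℕ → A) := fun m => {x | ¬ Occurs m x z n} with hU
  have hUm : ∀ m, MeasurableSet (U m) := fun m => (measurableSet_setOf_occurs m z n).compl
  let B : Finset (Fin m → A) := Finset.univ.filter fun b => (U m ∩ cyl b).Nonempty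
  have hUB : U m = ⋃ b ∈ B, cyl b := by
    ext x
    simp only [Set.mem_iUnion, B, Finset.mem_filter, Finset.mem_univ, true_and]
    constructor
    · intro hx
      exact ⟨word x m, ⟨x, hx, rfl⟩, rfl⟩
    · rintro ⟨b, ⟨w, hw, hwb⟩, hxb⟩ hocc
      refine hw ?_
      have hwx : word w m = word x m := Eq.trans hwb (Eq.symm hxb)
      rw [word_eq_word_iff] at hwx
      rw [occurs_iff] at hocc ⊢
      obtain ⟨r, hr, h⟩ := hocc
      exact ⟨r, hr, fun i hi => by rw [hwx _ (by omega), h i hi]⟩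
  have hdisj : Set.PairwiseDisjoint (B : Set (Fin m → A)) fun b => cyl b := by
    intro b _ b' _ hbb
    refine Set.disjoint_left.2 fun x hx hx' => hbb ?_
    exact Eq.trans (Eq.symm hx) hx'
  have hsub : U (n + t + m) ⊆ shift^[n + t] ⁻¹' U m ∩ U (n + t) := by
    intro x hx
    refine ⟨fun hocc => hx ?_, fun hocc => hx (hocc.mono (by omega) le_rfl)⟩
    rw [occurs_iff] at hocc ⊢
    obtain ⟨r, hr, h⟩ := hocc
    refine ⟨r + (n + t), by omega, fun i hi => ?_⟩
    rw [← h i hi, iterate_shift_apply, add_assoc]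
  have hpre : P.real (shift^[n + t] ⁻¹' U m) = P.real (U m) := by
    rw [measureReal_def, measureReal_def,
      (hP.iterate _).measure_preimage (hUm m).nullMeasurableSet]
  have hcyl : ∀ b : Fin m → A,
      q * P.real (cyl b) ≤ P.real (shift^[n + t] ⁻¹' cyl b \ U (n + t)) := by
    intro b
    by_cases hb : b ∈ suppWords P m
    · obtain ⟨l, hl, ξ, hξ⟩ := hq b hb
      refine hξ.trans ?_
      -- Shifting by t - l puts `b` at position n + t whatever the gap length l.
      have h1 : P.real (cyl (concat (word z n) ξ b)) =
          P.real (shift^[t - l] ⁻¹' cyl (concat (word z n) ξ b)) := by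
        rw [measureReal_def, measureReal_def, measure_preimage_iterate_shift hP]
      rw [h1]
      refine measureReal_mono fun x hx => ?_
      obtain ⟨h2, h3⟩ := word_eq_of_mem_cyl_concat hx
      rw [← Function.iterate_add_apply, show n + l + (t - l) = n + t by omega] at h3
      exact ⟨h3, fun hx' => hx' ⟨t - l, by omega, h2⟩⟩
    · have : P (cyl b) = 0 := by simpa [suppWords] using hb
      simp [measureReal_def, this]
  have hdiff : q * P.real (U m) ≤ P.real (shift^[n + t] ⁻¹' U m \ U (n + t)) := by
    have h1 : P.real (U m) = ∑ b ∈ B, P.real (cyl b) := by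
      rw [hUB]
      exact measureReal_biUnion_finset hdisj fun b _ => measurableSet_cyl b
    have h2 : shift^[n + t] ⁻¹' U m \ U (n + t) =
        ⋃ b ∈ B, (shift^[n + t] ⁻¹' cyl b \ U (n + t)) := by
      rw [hUB]
      ext x
      simp only [Set.mem_sdiff, Set.mem_preimage, Set.mem_iUnion, exists_prop]
      constructor
      · rintro ⟨⟨b, hb, hx⟩, hx'⟩
        exact ⟨b, hb, hx, hx'⟩
      · rintro ⟨b, hb, hx, hx'⟩
        exact ⟨⟨b, hb, hx⟩, hx'⟩
    rw [h1, h2, Finset.mul_sum, measureReal_biUnion_finset]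
    · exact Finset.sum_le_sum fun b _ => hcyl b
    · intro b hb b' hb' hbb
      exact ((hdisj hb hb' hbb).preimage _).mono Set.sdiff_subset Set.sdiff_subset
    · exact fun b _ => (measurable_iterate_shift _ (measurableSet_cyl b)).diff (hUm _)
  have hsplit : P.real (shift^[n + t] ⁻¹' U m ∩ U (n + t)) +
      P.real (shift^[n + t] ⁻¹' U m \ U (n + t)) = P.real (shift^[n + t] ⁻¹' U m) :=
    measureReal_inter_add_sdiff (hUm _)
  have hmono := measureReal_mono (μ := P) hsub
  rw [hpre] at hsplit
  change P.real (U (n + t + m)) ≤ (1 - q) * P.real (U m)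
  linarith

/-- Under selective lower decoupling, a word `a` of length `n` is missed by `x_1^N` with probability
at most `(1 - e^{-k_n} P[a])^j`, if `j` disjoint blocks of length `n + τ_n` fit into `x_1^N`. -/
lemma measureReal_not_occurs_le [IsProbabilityMeasure P] (hP : MeasurePreserving shift P P)
    {z : ℕ → A} {n t : ℕ} {q : ℝ} (hq1 : q ≤ 1)
    (hq : ∀ m, 1 ≤ m → ∀ b ∈ suppWords P m, ∃ l ≤ t, ∃ ξ : Fin l → A,
      q * P.real (cyl b) ≤ P.real (cyl (concat (word z n) ξ b)))
    {j N : ℕ} (hj : 1 + j * (n + t) ≤ N) :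
    P.real {x | ¬ Occurs N x z n} ≤ (1 - q) ^ j := by
  -- The extra symbol keeps the right-hand word nonempty, as decoupling requires, already in the
  -- first step.
  have h : ∀ j, P.real {x | ¬ Occurs (1 + j * (n + t)) x z n} ≤ (1 - q) ^ j := by
    intro j
    induction j with
    | zero => simp
    | succ j ih =>
      have h1 := measureReal_not_occurs_add_le hP (hq (1 + j * (n + t)) (by omega))
      rw [show 1 + (j + 1) * (n + t) = n + t + (1 + j * (n + t)) by ring, pow_succ']
      exact h1.trans (mul_le_mul_of_nonneg_left ih (by linarith))
  have hsub : {x | ¬ Occurs N x z n} ⊆ {x | ¬ Occurs (1 + j * (n + t)) x z n} :=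
    fun x hx hocc => hx (hocc.mono hj le_rfl)
  exact (measureReal_mono hsub).trans (h j)

/-- A word of independent sequences `x` and `y` of laws `P` and `Q` coincides with probability
`∑ P[a] Q[a]`. -/
lemma measure_prod_occurs_le [IsProbabilityMeasure P] [IsProbabilityMeasure Q]
    (hP : MeasurePreserving shift P P) (hQ : MeasurePreserving shift Q Q) (N R : ℕ) :
    P.prod Q {xy | ∃ k < N, Occurs N xy.1 (shift^[k] xy.2) R} ≤
      N * ((N + 1 : ℕ) * ∑ a : Fin R → A, P (cyl a) * Q (cyl a)) := by
  have hsub : {xy : (ℕ → A) × (ℕ → A) | ∃ k < N, Occurs N xy.1 (shift^[k] xy.2) R} ⊆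
      ⋃ k ∈ Finset.range N, ⋃ r ∈ Finset.range (N + 1), ⋃ a ∈ (Finset.univ : Finset (Fin R → A)),
        (shift^[r] ⁻¹' cyl a) ×ˢ (shift^[k] ⁻¹' cyl a) := by
    rintro ⟨x, y⟩ ⟨k, hk, r, hr, h⟩
    simp only [Set.mem_iUnion, Finset.mem_range]
    exact ⟨k, hk, r, by omega, word (shift^[k] y) R, Finset.mem_univ _, h, rfl⟩
  refine (measure_mono hsub).trans ((measure_biUnion_finset_le _ _).trans ?_)
  refine (Finset.sum_le_card_nsmul _ _ _ fun k _ => ?_).trans_eq (by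
    rw [Finset.card_range, nsmul_eq_mul])
  refine (measure_biUnion_finset_le _ _).trans ?_
  refine (Finset.sum_le_card_nsmul _ _ _ fun r _ => ?_).trans_eq (by
    rw [Finset.card_range, nsmul_eq_mul])
  refine (measure_biUnion_finset_le _ _).trans (Finset.sum_le_sum fun a _ => ?_)
  rw [Measure.prod_prod, measure_preimage_iterate_shift hP, measure_preimage_iterate_shift hQ]

/-- Markov's inequality for the number of events that occur in a finite family. -/
lemma measure_card_ge_le {Ω : Type*} [MeasurableSpace Ω] {μ : Measure Ω} (s : Finset ℕ)
    {E : ℕ → Set Ω} [∀ x, DecidablePred fun k => x ∈ E k] (hE : ∀ k, MeasurableSet (E k)) {p T : ℝ}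
    (hT : 0 < T) (hp : ∀ k ∈ s, μ (E k) ≤ ENNReal.ofReal p) :
    μ {x | T ≤ (s.filter fun k => x ∈ E k).card} ≤ ENNReal.ofReal (s.card * p / T) := by
  have hcount : ∀ x, (((s.filter fun k => x ∈ E k).card : ℕ) : ENNReal) =
      ∑ k ∈ s, (E k).indicator (fun _ => (1 : ENNReal)) x := by
    intro x
    rw [Finset.card_filter, Nat.cast_sum]
    refine Finset.sum_congr rfl fun k _ => ?_
    by_cases h : x ∈ E k <;> simp [h]
  have hset : {x | T ≤ (s.filter fun k => x ∈ E k).card} =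
      {x | ENNReal.ofReal T ≤ ∑ k ∈ s, (E k).indicator (fun _ => (1 : ENNReal)) x} := by
    ext x
    simp only [Set.mem_ofPred_eq]
    rw [← hcount, ← ENNReal.ofReal_natCast, ENNReal.ofReal_le_ofReal_iff (by positivity)]
  rw [hset, ENNReal.ofReal_div_of_pos hT]
  refine (meas_ge_le_lintegral_div (Finset.measurable_sum _ fun k _ =>
    measurable_const.indicator (hE k)).aemeasurable (by simpa using hT) ENNReal.ofReal_ne_top).trans
    ?_
  gcongr
  rw [lintegral_finsetSum _ fun k _ => measurable_const.indicator (hE k)]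
  simp only [lintegral_indicator_const (hE _), one_mul]
  refine (Finset.sum_le_card_nsmul _ _ _ hp).trans_eq ?_
  rw [nsmul_eq_mul, ENNReal.ofReal_mul (by positivity), ENNReal.ofReal_natCast]

end Probability

/-! ### Almost sure estimates on the occurrences -/

section AlmostSure

lemma ae_eventually_notMem_of_summable {Ω : Type*} [MeasurableSpace Ω] {μ : Measure Ω}
    {s : ℕ → Set Ω} {g : ℕ → ℝ} (hg : Summable g) (h : ∀ᶠ n in atTop, μ (s n) ≤ ENNReal.ofReal (g n)) :
    ∀ᵐ x ∂μ, ∀ᶠ n in atTop, x ∉ s n := by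
  obtain ⟨n₀, hn₀⟩ := eventually_atTop.1 h
  have hfin : ∑' n, μ (s (n + n₀)) ≠ ⊤ :=
    ne_top_of_le_ne_top ((summable_nat_add_iff n₀).2 hg).tsum_ofReal_ne_top
      (ENNReal.tsum_le_tsum fun n => hn₀ _ (Nat.le_add_left _ _))
  filter_upwards [ae_eventually_notMem hfin] with x hx
  obtain ⟨m, hm⟩ := eventually_atTop.1 hx
  refine eventually_atTop.2 ⟨m + n₀, fun n hn => ?_⟩
  have := hm (n - n₀) (by omega)
  rwa [Nat.sub_add_cancel (by omega)] at this

/-- Used at t = ln N, where it says that a small power of N absorbs logarithmic factors. -/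
lemma eventually_linear_le_exp (a b : ℝ) {c : ℝ} (hc : 0 < c) :
    ∀ᶠ t : ℝ in atTop, a * t + b ≤ Real.exp (c * t) := by
  filter_upwards [eventually_ge_atTop 1, eventually_ge_atTop (4 * (|a| + |b|) / c ^ 2)] with t h1 h2
  have h3 : c / 2 * t ≤ Real.exp (c / 2 * t) := by linarith [Real.add_one_le_exp (c / 2 * t)]
  have h4 : Real.exp (c * t) = Real.exp (c / 2 * t) ^ 2 := by
    rw [← Real.exp_nat_mul]; congr 1; push_cast; ring
  have h5 : (c / 2 * t) ^ 2 ≤ Real.exp (c / 2 * t) ^ 2 := by gcongr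
  rw [div_le_iff₀ (by positivity)] at h2
  have h6 : a * t ≤ |a| * t := by gcongr; exact le_abs_self a
  have h7 : b ≤ |b| * t := (le_abs_self b).trans (le_mul_of_one_le_right (abs_nonneg _) h1)
  rw [h4]
  nlinarith

/-- Puts an o(n) error into a form that can be summed over words of any length: the linear parts add
up to δN and the constants to D c_N = o(N). -/
lemma exists_le_linear {k : ℕ → ℝ} (hk : k =o[atTop] fun n : ℕ => (n : ℝ)) {δ : ℝ} (hδ : 0 < δ) :
    ∃ D, 0 ≤ D ∧ ∀ n, k n ≤ δ * n + D := by
  obtain ⟨n₀, hn₀⟩ := eventually_atTop.1 (hk.def hδ)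
  refine ⟨∑ n ∈ Finset.range n₀, |k n|, Finset.sum_nonneg fun _ _ => abs_nonneg _, fun n => ?_⟩
  rcases lt_or_ge n n₀ with h | h
  · have h1 := Finset.single_le_sum (f := fun n => |k n|) (fun _ _ => abs_nonneg _)
      (Finset.mem_range.2 h)
    have h2 : 0 ≤ δ * n := by positivity
    have h3 := le_abs_self (k n)
    linarith
  · have h1 := hn₀ n h
    have h2 : 0 ≤ ∑ n ∈ Finset.range n₀, |k n| := Finset.sum_nonneg fun _ _ => abs_nonneg _
    rw [Real.norm_eq_abs, Real.norm_eq_abs, Nat.abs_cast] at h1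
    linarith [le_abs_self (k n)]

lemma tendsto_log_natCast : Tendsto (fun N : ℕ => Real.log N) atTop atTop :=
  Real.tendsto_log_atTop.comp tendsto_natCast_atTop_atTop

lemma exp_neg_four_mul_log {N : ℕ} (hN : 0 < N) :
    Real.exp (-4 * Real.log N) = 1 / (N : ℝ) ^ 4 := by
  have h : (0 : ℝ) < N := by exact_mod_cast hN
  rw [neg_mul, Real.exp_neg, one_div, show (4 : ℝ) = ((4 : ℕ) : ℝ) by norm_num, Real.exp_nat_mul,
    Real.exp_log h]

lemma Nondegenerate.exists_sum_le {A : Type*} [Fintype A] [MeasurableSpace A]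
    {P Q : Measure (ℕ → A)} (h : Nondegenerate P Q) :
    ∃ c : ℝ, 0 < c ∧ ∀ᶠ n : ℕ in atTop,
      ∑ a : Fin n → A, P (cyl a) * Q (cyl a) ≤ ENNReal.ofReal (Real.exp (-c * n)) := by
  obtain ⟨b, hb, hb0⟩ := EReal.lt_iff_exists_real_btwn.1 h
  refine ⟨-b, by simpa using hb0, ?_⟩
  filter_upwards [ExpGrowth.eventually_le_exp hb] with n hn
  rw [neg_neg]
  have h1 : EReal.exp ((b : EReal) * n) = ENNReal.ofReal (Real.exp (b * n)) := by
    rw [← EReal.exp_coe]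
    congr 1
  rw [← h1]
  classical
  refine le_trans (le_of_eq ?_) hn
  symm
  refine Finset.sum_subset_zero_on_sdiff (Finset.subset_univ _) (fun a ha => ?_) fun a _ => by simp
  have : P (cyl a) = 0 := by
    by_contra h0
    exact (Finset.mem_sdiff.1 ha).2
      (Finset.mem_filter.2 ⟨Finset.mem_univ a, pos_iff_ne_zero.2 h0⟩)
  simp [this]

variable {A : Type*} [MeasurableSpace A] [MeasurableSingletonClass A]
  {P Q : Measure (ℕ → A)} [IsProbabilityMeasure P]

/-- Almost surely, few positions of a given sequence start unlikely words that occur. -/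
lemma ae_eventually_exists_exceptional (hP : MeasurePreserving shift P P) (y : ℕ → A) {ε : ℝ}
    (hε : 0 < ε) (hε1 : ε ≤ 1) :
    ∀ᵐ x ∂P, ∀ᶠ N : ℕ in atTop, ∃ B : Finset ℕ,
      (B.card : ℝ) ≤ Real.exp ((1 - ε / 2) * Real.log N) ∧
      ∀ k < N, k ∉ B → ∀ n, Occurs N x (shift^[k] y) n →
        Real.exp (-(1 + ε) * Real.log N) ≤ P.real (cyl (word (shift^[k] y) n)) := by
  classical
  -- Markov's inequality gives a bound of order N^{-ε/2}, which is not summable over N but is over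
  -- dyadic scales. For 2^j ≤ N < 2^{j+1}, the threshold is taken at 2^j and the window at 2^{j+1},
  -- so that a single event serves all these N.
  let E : ℕ → ℕ → Set (ℕ → A) := fun j k =>
    {x | ∃ n, P.real (cyl (word (shift^[k] y) n)) < Real.exp (-(1 + ε) * (j * Real.log 2)) ∧
      Occurs (2 * 2 ^ j) x (shift^[k] y) n}
  have hEm : ∀ j k, MeasurableSet (E j k) := by
    intro j k
    have : E j k = ⋃ n, ⋃ (_ : P.real (cyl (word (shift^[k] y) n)) <
        Real.exp (-(1 + ε) * (j * Real.log 2))), {x | Occurs (2 * 2 ^ j) x (shift^[k] y) n} := by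
      ext x
      simp [E]
    rw [this]
    exact .iUnion fun n => .iUnion fun _ => measurableSet_setOf_occurs _ _ _
  let s : ℕ → Set (ℕ → A) := fun j => {x | Real.exp ((1 - ε / 2) * (j * Real.log 2)) ≤
    ((Finset.range (2 * 2 ^ j)).filter fun k => x ∈ E j k).card}
  have hlog2 : 0 < Real.log 2 := Real.log_pos one_lt_two
  have hsummable : Summable fun j : ℕ => 6 * Real.exp (-(ε / 2 * Real.log 2)) ^ j :=
    (summable_geometric_of_lt_one (Real.exp_pos _).le
      (Real.exp_lt_one_iff.2 (neg_neg_of_pos (by positivity)))).mul_left 6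
  have hbound : ∀ j, P (s j) ≤ ENNReal.ofReal (6 * Real.exp (-(ε / 2 * Real.log 2)) ^ j) := by
    intro j
    refine (measure_card_ge_le (E := E j) (Finset.range (2 * 2 ^ j)) (hEm j) (Real.exp_pos _)
      fun k _ => measure_exists_occurs_le hP _ _ _).trans (ENNReal.ofReal_le_ofReal ?_)
    have hM : (2 : ℝ) ^ j = Real.exp (j * Real.log 2) := by
      rw [Real.exp_nat_mul, Real.exp_log two_pos]
    rw [Finset.card_range, div_le_iff₀ (Real.exp_pos _), ← Real.exp_nat_mul]
    push_cast
    have h1 : (1 : ℝ) ≤ 2 ^ j := one_le_pow₀ one_le_two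
    calc (2 : ℝ) * 2 ^ j * ((2 * 2 ^ j + 1) * Real.exp (-(1 + ε) * (j * Real.log 2)))
        ≤ 2 * 2 ^ j * ((2 * 2 ^ j + 2 ^ j) * Real.exp (-(1 + ε) * (j * Real.log 2))) := by gcongr
      _ = 6 * (2 ^ j * 2 ^ j * Real.exp (-(1 + ε) * (j * Real.log 2))) := by ring
      _ = 6 * (Real.exp (j * -(ε / 2 * Real.log 2)) *
            Real.exp ((1 - ε / 2) * (j * Real.log 2))) := by
          rw [hM, ← Real.exp_add, ← Real.exp_add, ← Real.exp_add]
          congr 2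
          ring
      _ = _ := by ring
  filter_upwards [ae_eventually_notMem_of_summable hsummable (Eventually.of_forall hbound)] with x hx
  have htend : Tendsto (Nat.log 2) atTop atTop :=
    tendsto_atTop_mono (f := fun N : ℕ => Nat.log 2 N) (fun N => le_rfl) (by
      refine tendsto_atTop.2 fun b => ?_
      filter_upwards [eventually_ge_atTop (2 ^ b)] with N hN
      exact Nat.le_log_of_pow_le one_lt_two hN)
  filter_upwards [htend.eventually hx, eventually_ge_atTop 1] with N hN hN1
  set j := Nat.log 2 N with hj
  have hjN : 2 ^ j ≤ N := Nat.pow_log_le_self 2 (by omega)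
  have hNj : N < 2 * 2 ^ j := by
    have := Nat.lt_pow_succ_log_self one_lt_two N
    rw [pow_succ, ← hj] at this
    omega
  have hlog : j * Real.log 2 ≤ Real.log N := by
    rw [← Real.log_pow]
    exact Real.log_le_log (by positivity) (by exact_mod_cast hjN)
  refine ⟨(Finset.range (2 * 2 ^ j)).filter fun k => x ∈ E j k, ?_, fun k hk hkB n hocc => ?_⟩
  · refine (not_le.1 (Set.notMem_ofPred_iff.1 hN)).le.trans (Real.exp_le_exp.2 ?_)
    gcongr
    linarith
  · by_contra hlt
    refine hkB (Finset.mem_filter.2 ⟨Finset.mem_range.2 (by omega), n, ?_,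
      hocc.mono hNj.le le_rfl⟩)
    refine (not_le.1 hlt).trans_le (Real.exp_le_exp.2 ?_)
    nlinarith

variable [Fintype A] [IsProbabilityMeasure Q]

/-- Almost surely, the matches are at most logarithmically long. -/
lemma Nondegenerate.ae_eventually_not_occurs (h : Nondegenerate P Q)
    (hP : MeasurePreserving shift P P) (hQ : MeasurePreserving shift Q Q) :
    ∃ C : ℝ, 0 < C ∧ ∀ᵐ xy ∂(P.prod Q), ∀ᶠ N : ℕ in atTop, ∀ k < N,
      ¬ Occurs N xy.1 (shift^[k] xy.2) ⌈C * Real.log N⌉₊ := by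
  obtain ⟨c, hc, hsum⟩ := h.exists_sum_le
  -- At this length two words coincide with probability at most N^{-4}; the N(N + 1) pairs of
  -- positions leave a summable 2N^{-2}.
  refine ⟨4 / c, by positivity, ?_⟩
  have hR : Tendsto (fun N : ℕ => ⌈4 / c * Real.log N⌉₊) atTop atTop :=
    tendsto_nat_ceil_atTop.comp (tendsto_log_natCast.const_mul_atTop (by positivity))
  have hsummable : Summable fun N : ℕ => 2 * (1 / (N : ℝ) ^ 2) :=
    (Real.summable_one_div_nat_pow.2 one_lt_two).mul_left 2
  have hbound : ∀ᶠ N : ℕ in atTop,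
      P.prod Q {xy | ∃ k < N, Occurs N xy.1 (shift^[k] xy.2) ⌈4 / c * Real.log N⌉₊} ≤
        ENNReal.ofReal (2 * (1 / (N : ℝ) ^ 2)) := by
    filter_upwards [hR.eventually hsum, eventually_ge_atTop 1] with N hN hN1
    refine (measure_prod_occurs_le hP hQ N _).trans ?_
    have hexp : Real.exp (-c * ⌈4 / c * Real.log N⌉₊) ≤ 1 / (N : ℝ) ^ 4 := by
      rw [← exp_neg_four_mul_log (by omega)]
      refine Real.exp_le_exp.2 ?_
      have h1 := Nat.le_ceil (4 / c * Real.log N)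
      have h2 := mul_le_mul_of_nonneg_left h1 hc.le
      rw [← mul_assoc, mul_div_cancel₀ _ hc.ne'] at h2
      linarith
    calc (N : ENNReal) * ((N + 1 : ℕ) * ∑ a : Fin ⌈4 / c * Real.log N⌉₊ → A, P (cyl a) * Q (cyl a))
        ≤ N * ((N + 1 : ℕ) * ENNReal.ofReal (1 / (N : ℝ) ^ 4)) := by
          gcongr
          exact hN.trans (ENNReal.ofReal_le_ofReal hexp)
      _ = ENNReal.ofReal (N * ((N + 1 : ℕ) * (1 / (N : ℝ) ^ 4))) := by
          rw [ENNReal.ofReal_mul (by positivity), ENNReal.ofReal_mul (by positivity),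
            ENNReal.ofReal_natCast, ENNReal.ofReal_natCast]
      _ ≤ ENNReal.ofReal (2 * (1 / (N : ℝ) ^ 2)) := by
          refine ENNReal.ofReal_le_ofReal ?_
          have hN' : (1 : ℝ) ≤ N := by exact_mod_cast hN1
          have h3 : (N : ℝ) * ((N + 1 : ℕ) * (1 / (N : ℝ) ^ 4)) = (N * (N + 1)) / (N : ℝ) ^ 4 := by
            push_cast; ring
          rw [h3, div_le_iff₀ (by positivity)]
          have h4 : 2 * (1 / (N : ℝ) ^ 2) * (N : ℝ) ^ 4 = 2 * (N : ℝ) ^ 2 := by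
            field_simp
          rw [h4]
          nlinarith
  filter_upwards [ae_eventually_notMem_of_summable hsummable hbound] with xy hxy
  filter_upwards [hxy] with N hN k hk hocc
  exact hN ⟨k, hk, hocc⟩

/-- Almost surely, the likely short words of a given sequence occur. -/
lemma SelectivelyLowerDecoupled.ae_eventually_occurs (h : SelectivelyLowerDecoupled P)
    (hP : MeasurePreserving shift P P) {y : ℕ → A}
    (hy : ∀ k n, word (shift^[k] y) n ∈ suppWords P n) {C ε : ℝ} (hC : 0 < C) (hε : 0 < ε)
    (hε1 : ε ≤ 1) :
    ∀ᵐ x ∂P, ∀ᶠ N : ℕ in atTop, ∀ k < N, ∀ n, 1 ≤ n → n ≤ ⌈C * Real.log N⌉₊ + 1 →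
      Real.exp (-(1 - ε) * Real.log N) ≤ P.real (cyl (word (shift^[k] y) n)) →
      Occurs N x (shift^[k] y) n := by
  obtain ⟨κ, τ, -, hκ, hτ, hdec⟩ := h
  -- For n ≤ C ln N + 2 this slope makes the decoupling cost at most (ε/4) ln N.
  obtain ⟨D₁, hD₁, hκ'⟩ := exists_le_linear hκ (δ := ε / (8 * C)) (by positivity)
  obtain ⟨D₂, hD₂, hτ'⟩ := exists_le_linear hτ (δ := 1) one_pos
  let s : ℕ → Set (ℕ → A) := fun N => {x | ∃ k < N, ∃ n, 1 ≤ n ∧ n ≤ ⌈C * Real.log N⌉₊ + 1 ∧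
      Real.exp (-(1 - ε) * Real.log N) ≤ P.real (cyl (word (shift^[k] y) n)) ∧
      ¬ Occurs N x (shift^[k] y) n}
  have hsummable : Summable fun N : ℕ => 1 / (N : ℝ) ^ 2 :=
    Real.summable_one_div_nat_pow.2 one_lt_two
  have hbound : ∀ᶠ N : ℕ in atTop, P (s N) ≤ ENNReal.ofReal (1 / (N : ℝ) ^ 2) := by
    filter_upwards [eventually_ge_atTop 1,
      tendsto_log_natCast.eventually_ge_atTop ((ε / (8 * C) * 2 + D₁) / (ε / 8)),
      tendsto_log_natCast.eventually_ge_atTop 0,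
      tendsto_log_natCast.eventually (eventually_linear_le_exp 4 0 (half_pos hε)),
      tendsto_log_natCast.eventually (eventually_linear_le_exp C 2 one_pos),
      tendsto_log_natCast.eventually (eventually_linear_le_exp (4 * C) (8 + 2 * D₂ + 1)
        (c := ε / 4) (by positivity))] with N hN1 hL1 hL0 hL2 hL3 hL4
    have hN0 : (0 : ℝ) < N := by exact_mod_cast hN1
    set L := Real.log N with hL
    have hexpL : Real.exp L = N := Real.exp_log hN0
    have hCL : 0 ≤ C * L := by positivity
    have hn_le : ∀ n : ℕ, n ≤ ⌈C * L⌉₊ + 1 → (n : ℝ) ≤ C * L + 2 := fun n hn => by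
      have h1 : (n : ℝ) ≤ (⌈C * L⌉₊ : ℝ) + 1 := by exact_mod_cast hn
      linarith [Nat.ceil_lt_add_one hCL]
    have hone : ∀ k n, 1 ≤ n → n ≤ ⌈C * L⌉₊ + 1 →
        Real.exp (-(1 - ε) * L) ≤ P.real (cyl (word (shift^[k] y) n)) →
        P {x | ¬ Occurs N x (shift^[k] y) n} ≤ ENNReal.ofReal (1 / (N : ℝ) ^ 4) := by
      intro k n hn1 hn hPn
      have hnL := hn_le n hn
      have hκn : κ n ≤ ε / 4 * L := by
        have h1 := hκ' n
        have h2 : ε / (8 * C) * n ≤ ε / (8 * C) * (C * L + 2) := by gcongr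
        have h3 : ε / (8 * C) * (C * L + 2) = ε / 8 * L + ε / (8 * C) * 2 := by
          field_simp
        rw [div_le_iff₀ (by positivity)] at hL1
        linarith
      -- About N^{1-ε/4} blocks of length O(ln N) fit into N symbols, while q ≥ N^{-(1-3ε/4)} gives
      -- jq ≥ N^{ε/2} ≥ 4 ln N, so all blocks miss with probability at most N^{-4}.
      set j := ⌈Real.exp ((1 - ε / 4) * L)⌉₊ with hj
      have hj1 : Real.exp ((1 - ε / 4) * L) ≤ j := Nat.le_ceil _
      set q := Real.exp (-κ n) * P.real (cyl (word (shift^[k] y) n)) with hq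
      have hq_ge : Real.exp (-(1 - 3 * ε / 4) * L) ≤ q := by
        have h1 : Real.exp (-(1 - 3 * ε / 4) * L) =
            Real.exp (-(ε / 4 * L)) * Real.exp (-(1 - ε) * L) := by
          rw [← Real.exp_add]; congr 1; ring
        rw [h1, hq]
        gcongr
      by_cases hjN : 1 + j * (n + τ n) ≤ N
      · have hdec' : ∀ m, 1 ≤ m → ∀ b ∈ suppWords P m, ∃ l ≤ τ n, ∃ ξ : Fin l → A,
            q * P.real (cyl b) ≤ P.real (cyl (concat (word (shift^[k] y) n) ξ b)) := by
          intro m hm b hb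
          obtain ⟨l, hl, ξ, -, hξ⟩ := hdec n hn1 _ (hy k n) m hm b hb
          exact ⟨l, hl, ξ, by rw [hq, mul_assoc]; exact hξ⟩
        -- For a one-letter word b of the support, decoupling and invariance give q P[b] ≤ P[aξb] ≤
        -- P[b].
        have hq1 : q ≤ 1 := by
          obtain ⟨l, -, ξ, hξ⟩ := hdec' 1 le_rfl _ (hy 0 1)
          have hpos : 0 < P.real (cyl (word (shift^[0] y) 1)) :=
            ENNReal.toReal_pos (ne_of_gt (hy 0 1)) (measure_ne_top _ _)
          have hsub : cyl (concat (word (shift^[k] y) n) ξ (word (shift^[0] y) 1)) ⊆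
              shift^[n + l] ⁻¹' cyl (word (shift^[0] y) 1) :=
            fun w hw => (word_eq_of_mem_cyl_concat hw).2
          have hle := measureReal_mono (μ := P) hsub
          have heq : P.real (shift^[n + l] ⁻¹' cyl (word (shift^[0] y) 1)) =
              P.real (cyl (word (shift^[0] y) 1)) := by
            rw [measureReal_def, measureReal_def, measure_preimage_iterate_shift hP]
          rw [heq] at hle
          exact le_of_mul_le_mul_right (by linarith) hpos
        have h1 := measureReal_not_occurs_le hP hq1 hdec' hjN
        rw [← ofReal_measureReal, ← exp_neg_four_mul_log (by omega)]
        refine ENNReal.ofReal_le_ofReal (h1.trans ?_)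
        calc (1 - q) ^ j ≤ Real.exp (-q) ^ j := by
              have h0 : 0 ≤ 1 - q := by linarith
              have h2 : 1 - q ≤ Real.exp (-q) := by linarith [Real.add_one_le_exp (-q)]
              gcongr
          _ = Real.exp (-(j * q)) := by rw [← Real.exp_nat_mul]; congr 1; ring
          _ ≤ Real.exp (-4 * L) := by
              refine Real.exp_le_exp.2 ?_
              have h2 : Real.exp ((1 - ε / 4) * L) * Real.exp (-(1 - 3 * ε / 4) * L) ≤ j * q := by
                gcongr
              have h3 : Real.exp ((1 - ε / 4) * L) * Real.exp (-(1 - 3 * ε / 4) * L) =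
                  Real.exp (ε / 2 * L) := by
                rw [← Real.exp_add]; congr 1; ring
              linarith
      · exfalso
        apply hjN
        have hτn := hτ' n
        rw [one_mul] at hτn
        have hsgn : 0 ≤ (1 - ε / 4) * L := mul_nonneg (by linarith) hL0
        have h1 : (j : ℝ) ≤ 2 * Real.exp ((1 - ε / 4) * L) := by
          have h2 := Nat.ceil_lt_add_one (Real.exp_pos ((1 - ε / 4) * L)).le
          have h3 : 1 ≤ Real.exp ((1 - ε / 4) * L) := Real.one_le_exp hsgn
          linarith
        have h3 : 1 ≤ Real.exp ((1 - ε / 4) * L) := Real.one_le_exp hsgn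
        have h4 : (n : ℝ) + τ n ≤ 2 * (C * L + 2) + D₂ := by linarith
        have h5 : (1 : ℝ) + j * (n + τ n) ≤ N := by
          calc (1 : ℝ) + j * (n + τ n)
              ≤ Real.exp ((1 - ε / 4) * L) +
                2 * Real.exp ((1 - ε / 4) * L) * (2 * (C * L + 2) + D₂) := by gcongr
            _ = Real.exp ((1 - ε / 4) * L) * (4 * C * L + (8 + 2 * D₂ + 1)) := by ring
            _ ≤ Real.exp ((1 - ε / 4) * L) * Real.exp (ε / 4 * L) := by gcongr
            _ = N := by rw [← hexpL, ← Real.exp_add]; congr 1; ring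
        exact_mod_cast h5
    have hsub : s N ⊆ ⋃ k ∈ Finset.range N, ⋃ n ∈ Finset.Icc 1 (⌈C * L⌉₊ + 1),
        {x | Real.exp (-(1 - ε) * L) ≤ P.real (cyl (word (shift^[k] y) n)) ∧
          ¬ Occurs N x (shift^[k] y) n} := by
      rintro x ⟨k, hk, n, hn1, hn, hx⟩
      simp only [Set.mem_iUnion, Finset.mem_range, Finset.mem_Icc]
      exact ⟨k, hk, n, ⟨hn1, hn⟩, hx⟩
    refine (measure_mono hsub).trans ((measure_biUnion_finset_le _ _).trans ?_)
    calc ∑ k ∈ Finset.range N, P (⋃ n ∈ Finset.Icc 1 (⌈C * L⌉₊ + 1),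
          {x | Real.exp (-(1 - ε) * L) ≤ P.real (cyl (word (shift^[k] y) n)) ∧
            ¬ Occurs N x (shift^[k] y) n})
        ≤ ∑ k ∈ Finset.range N, ∑ n ∈ Finset.Icc 1 (⌈C * L⌉₊ + 1),
            ENNReal.ofReal (1 / (N : ℝ) ^ 4) := by
          refine Finset.sum_le_sum fun k _ => (measure_biUnion_finset_le _ _).trans
            (Finset.sum_le_sum fun n hn => ?_)
          rw [Finset.mem_Icc] at hn
          by_cases hPn : Real.exp (-(1 - ε) * L) ≤ P.real (cyl (word (shift^[k] y) n))
          · simp only [hPn, true_and]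
            exact hone k n hn.1 hn.2 hPn
          · have hempty : {x | Real.exp (-(1 - ε) * L) ≤ P.real (cyl (word (shift^[k] y) n)) ∧
                ¬ Occurs N x (shift^[k] y) n} = ∅ :=
              Set.eq_empty_of_forall_notMem fun x hx => hPn hx.1
            rw [hempty, measure_empty]
            exact zero_le
      _ = ENNReal.ofReal (N * ((⌈C * L⌉₊ + 1 : ℕ) * (1 / (N : ℝ) ^ 4))) := by
          rw [Finset.sum_const, Finset.sum_const, Finset.card_range, Nat.card_Icc, nsmul_eq_mul,
            nsmul_eq_mul, ENNReal.ofReal_mul (by positivity), ENNReal.ofReal_mul (by positivity),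
            ENNReal.ofReal_natCast, ENNReal.ofReal_natCast, Nat.add_sub_cancel]
      _ ≤ ENNReal.ofReal (1 / (N : ℝ) ^ 2) := by
          refine ENNReal.ofReal_le_ofReal ?_
          have h1 : ((⌈C * L⌉₊ + 1 : ℕ) : ℝ) ≤ N := by
            have := hn_le _ le_rfl
            rw [one_mul, hexpL] at hL3
            linarith
          calc (N : ℝ) * ((⌈C * L⌉₊ + 1 : ℕ) * (1 / (N : ℝ) ^ 4))
              ≤ N * (N * (1 / (N : ℝ) ^ 4)) := by gcongr
            _ = 1 / (N : ℝ) ^ 2 := by field_simp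
  filter_upwards [ae_eventually_notMem_of_summable hsummable hbound] with x hx
  filter_upwards [hx] with N hN k hk n hn1 hn hPn
  by_contra hocc
  exact hN ⟨k, hk, n, hn1, hn, hPn, hocc⟩

end AlmostSure

/-! ### Potentials of weak Gibbs measures -/

section Potential

lemma abs_birkhoffSum_le {α : Type*} {T : α → α} {f : α → ℝ} {M : ℝ} (hM : ∀ x, |f x| ≤ M)
    (n : ℕ) (x : α) : |birkhoffSum T f n x| ≤ n * M := by
  refine (Finset.abs_sum_le_sum_abs _ _).trans
    ((Finset.sum_le_card_nsmul _ _ M fun i _ => hM _).trans_eq ?_)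
  rw [Finset.card_range, nsmul_eq_mul]

variable {A : Type*} [MeasurableSpace A] {P Q : Measure (ℕ → A)}

/-- Each cylinder around a point of the support has positive measure, hence meets Ω; the points so
found converge to the given one. -/
lemma suppSeq_subset_of_isClosed [TopologicalSpace A] {Ω : Set (ℕ → A)} (hΩ : IsClosed Ω)
    (hP : ∀ᵐ x ∂P, x ∈ Ω) : suppSeq P ⊆ Ω := by
  intro x hx
  have hne : ∀ n, ∃ w, w ∈ cyl (word x n) ∧ w ∈ Ω := by
    intro n
    by_contra! hcon
    have : P (cyl (word x n)) = 0 := measure_mono_null (fun w hw => hcon w hw) hP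
    exact (hx n).ne' this
  choose w hw hwΩ using hne
  refine hΩ.mem_of_tendsto (f := w) (b := atTop) (tendsto_pi_nhds.2 fun i => ?_)
    (Eventually.of_forall hwΩ)
  refine tendsto_const_nhds.congr' ?_
  filter_upwards [eventually_gt_atTop i] with n hn
  exact (word_eq_word_iff.1 (hw n) i hn).symm

variable [Fintype A]

lemma ae_mem_suppSeq (Q : Measure (ℕ → A)) : ∀ᵐ y ∂Q, y ∈ suppSeq Q := by
  refine ae_all_iff.2 fun n => ?_
  have hnull : Q (⋃ a ∈ {a : Fin n → A | Q (cyl a) = 0}, cyl a) = 0 :=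
    (measure_biUnion_null_iff (Set.to_countable _)).2 fun a ha => ha
  refine measure_mono_null (fun y hy => ?_) hnull
  have h0 : Q (cyl (word y n)) = 0 := by
    by_contra h0
    exact hy (pos_iff_ne_zero.2 h0)
  simp only [Set.mem_iUnion]
  exact ⟨word y n, h0, rfl⟩

/-- Take ψ = p_top(φ) - φ on Ω and 0 elsewhere: compactness of Ω makes it bounded, and the logarithm
of the Gibbs inequalities gives the estimate with κ_n = ln K_n. -/
lemma WeakGibbs.exists_potential [TopologicalSpace A] [DiscreteTopology A]
    [MeasurableSingletonClass A] (h : WeakGibbs P) :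
    ∃ (Ω : Set (ℕ → A)) (ψ : (ℕ → A) → ℝ) (M : ℝ) (κ : ℕ → ℝ),
      Set.MapsTo shift Ω Ω ∧ suppSeq P ⊆ Ω ∧ Measurable ψ ∧ (∀ x, |ψ x| ≤ M) ∧
      (κ =o[atTop] fun n : ℕ => (n : ℝ)) ∧
      ∀ n : ℕ, 1 ≤ n → ∀ y ∈ Ω, 0 < P.real (cyl (word y n)) ∧
        |birkhoffSum shift ψ n y + Real.log (P.real (cyl (word y n)))| ≤ κ n := by
  classical
  obtain ⟨Ω, φ, K, ⟨hcl, hmaps⟩, hPΩ, hφ, -, hK, hKo, hG⟩ := h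
  set p := topPressure Ω φ with hp
  obtain ⟨M, hM⟩ := (hcl.isCompact.exists_bound_of_continuousOn (f := fun x => p - φ x)
    (continuousOn_const.sub hφ))
  refine ⟨Ω, Ω.indicator fun x => p - φ x, max M 0, fun n => Real.log (K n), hmaps,
    suppSeq_subset_of_isClosed hcl hPΩ, ?_, fun x => ?_, hKo, fun n hn y hy => ?_⟩
  · rw [← Set.piecewise_eq_indicator]
    exact (continuousOn_const.sub hφ).measurable_piecewise continuousOn_const hcl.measurableSet
  · by_cases hx : x ∈ Ω
    · rw [Set.indicator_of_mem hx]
      exact (hM x hx).trans (le_max_left _ _)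
    · rw [Set.indicator_of_notMem hx]
      simp
  · have hsum : birkhoffSum shift (Ω.indicator fun x => p - φ x) n y =
        n * p - birkhoffSum shift φ n y := by
      have hmem : ∀ k, shift^[k] y ∈ Ω := fun k => hmaps.iterate k hy
      simp [birkhoffSum, hmem]
    obtain ⟨h1, h2⟩ := hG n hn y hy
    have hpos : 0 < P.real (cyl (word y n)) :=
      (mul_pos (inv_pos.2 (hK n)) (Real.exp_pos _)).trans_le h1
    refine ⟨hpos, ?_⟩
    have h3 := Real.log_le_log (mul_pos (inv_pos.2 (hK n)) (Real.exp_pos _)) h1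
    have h4 := Real.log_le_log hpos h2
    rw [Real.log_mul (inv_pos.2 (hK n)).ne' (Real.exp_pos _).ne', Real.log_inv, Real.log_exp] at h3
    rw [Real.log_mul (hK n).ne' (Real.exp_pos _).ne', Real.log_exp] at h4
    rw [hsum, abs_le]
    constructor <;> linarith

lemma sum_measureReal_cyl_mul [MeasurableSingletonClass A] [IsProbabilityMeasure Q] {n : ℕ}
    (f : (Fin n → A) → ℝ) : ∑ a : Fin n → A, Q.real (cyl a) * f a = ∫ y, f (word y n) ∂Q := by
  have hmap := integral_map (μ := Q) (measurable_word n).aemeasurable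
    (measurable_of_countable f).aestronglyMeasurable
  have hprob : IsProbabilityMeasure (Q.map fun y => word y n) :=
    Measure.isProbabilityMeasure_map (measurable_word n).aemeasurable
  rw [← hmap, integral_fintype .of_finite]
  refine Finset.sum_congr rfl fun a _ => ?_
  rw [smul_eq_mul, map_measureReal_apply (measurable_word n) (measurableSet_singleton a)]
  rfl

/-- By invariance the integral of S_nψ is exactly n∫ψ dQ, so integrating the pointwise estimate
leaves an error of at most κ_n/n. -/
lemma isCrossEntropy_of_potential [MeasurableSingletonClass A] [IsProbabilityMeasure Q]
    (hQ : MeasurePreserving shift Q Q) {ψ : (ℕ → A) → ℝ} (hψ : Measurable ψ) {M : ℝ}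
    (hM : ∀ x, |ψ x| ≤ M) {κ : ℕ → ℝ} (hκ : κ =o[atTop] fun n : ℕ => (n : ℝ))
    (h : ∀ n : ℕ, 1 ≤ n → ∀ᵐ y ∂Q,
      |birkhoffSum shift ψ n y + Real.log (P.real (cyl (word y n)))| ≤ κ n) :
    IsCrossEntropy Q P (∫ y, ψ y ∂Q) := by
  have hint : Integrable ψ Q := integrable_of_bounded hψ hM
  have hsum : ∀ n : ℕ, Integrable (birkhoffSum shift ψ n) Q ∧
      ∫ y, birkhoffSum shift ψ n y ∂Q = n * ∫ y, ψ y ∂Q := by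
    intro n
    have hk : ∀ k ∈ Finset.range n, Integrable (fun y => ψ (shift^[k] y)) Q := fun k _ =>
      (hQ.iterate k).integrable_comp_of_integrable hint
    refine ⟨integrable_finsetSum _ hk, ?_⟩
    simp only [birkhoffSum]
    rw [integral_finsetSum _ hk,
      Finset.sum_congr rfl fun k _ => integral_comp_eq (hQ.iterate k) hψ]
    simp
  refine tendsto_iff_norm_sub_tendsto_zero.2 (squeeze_zero_norm' ?_ hκ.tendsto_div_nhds_zero)
  filter_upwards [eventually_ge_atTop 1] with n hn
  have hn0 : (0 : ℝ) < n := by exact_mod_cast hn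
  have hlog : Integrable (fun y => Real.log (P.real (cyl (word y n)))) Q :=
    Integrable.comp_measurable (g := fun a : Fin n → A => Real.log (P.real (cyl a)))
      (by
        have : IsProbabilityMeasure (Q.map fun y => word y n) :=
          Measure.isProbabilityMeasure_map (measurable_word n).aemeasurable
        exact .of_finite) (measurable_word n)
  rw [sum_measureReal_cyl_mul fun a => Real.log (P.real (cyl a)), norm_norm]
  have h1 : -(1 / (n : ℝ)) * ∫ y, Real.log (P.real (cyl (word y n))) ∂Q - ∫ y, ψ y ∂Q =
      -(1 / n) * ∫ y, (birkhoffSum shift ψ n y + Real.log (P.real (cyl (word y n)))) ∂Q := by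
    rw [integral_add (hsum n).1 hlog, (hsum n).2]
    field_simp
    ring
  have h2 : |∫ y, (birkhoffSum shift ψ n y + Real.log (P.real (cyl (word y n)))) ∂Q| ≤ κ n := by
    have := norm_integral_le_of_norm_le_const (μ := Q) (C := κ n)
      (f := fun y => birkhoffSum shift ψ n y + Real.log (P.real (cyl (word y n)))) (h n hn)
    simpa using this
  rw [h1, norm_mul, norm_neg, Real.norm_eq_abs, Real.norm_eq_abs, abs_of_pos (by positivity)]
  calc 1 / (n : ℝ) * _ ≤ 1 / n * κ n := by gcongr
    _ = κ n / n := by ring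

end Potential

/-! ### Asymptotics of the number of words -/

lemma tendsto_log_div_natCast : Tendsto (fun N : ℕ => Real.log N / N) atTop (𝓝 0) := by
  have h := Real.isLittleO_log_id_atTop.comp_tendsto tendsto_natCast_atTop_atTop
  exact h.tendsto_div_nhds_zero

/-- The tolerance ε runs through 1/(m + 2), a countable family, so that almost sure statements can
be intersected over it. -/
lemma tendsto_estimator_of_bounds {c : ℕ → ℕ} {s : ℕ → ℝ} {h : ℝ}
    (hs : Tendsto (fun N : ℕ => s N / N) atTop (𝓝 h))
    (hU : ∀ m : ℕ, ∃ D : ℝ, ∀ᶠ N : ℕ in atTop,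
      ((c N : ℝ) - 1) * ((1 - 1 / ((m : ℝ) + 2)) * Real.log N) ≤
        s N + 1 / ((m : ℝ) + 2) * N + D * c N)
    (hL : ∀ m : ℕ, ∃ D D' : ℝ, ∀ᶠ N : ℕ in atTop,
      s N ≤ c N * ((1 + 1 / ((m : ℝ) + 2)) * Real.log N + D) +
        Real.exp ((1 - 1 / ((m : ℝ) + 2) / 2) * Real.log N) * (D' * Real.log N + D') +
        1 / ((m : ℝ) + 2) * N) :
    Tendsto (fun N : ℕ => (c N : ℝ) * Real.log N / ((N : ℝ) - c N)) atTop (𝓝 h) := by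
  set u : ℕ → ℝ := fun N => c N * Real.log N / N with hu
  have hlog_ge : ∀ b, ∀ᶠ N : ℕ in atTop, b ≤ Real.log N := tendsto_log_natCast.eventually_ge_atTop
  have hN1 : ∀ᶠ N : ℕ in atTop, (0 : ℝ) < N := by
    filter_upwards [eventually_gt_atTop 0] with N hN
    exact_mod_cast hN
  have hu0 : ∀ᶠ N in atTop, 0 ≤ u N := by
    filter_upwards [hlog_ge 0] with N hN
    positivity
  -- A crude bound from ε = 1/2: once ln N ≥ 4D, half of the main term absorbs D c_N. It yields
  -- c_N/N = O(1/ln N), which makes the terms D c_N negligible for every other ε.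
  have hub : ∃ Bd, ∀ᶠ N in atTop, u N ≤ Bd := by
    obtain ⟨D, hD⟩ := hU 0
    refine ⟨4 * (h + 2), ?_⟩
    filter_upwards [hD, hlog_ge (4 * D), hlog_ge 0, hN1, hs.eventually_le_const (lt_add_one h),
      tendsto_log_div_natCast.eventually_le_const one_pos] with N h1 h2 h3 h4 h5 h6
    rw [div_le_iff₀ h4] at h5 h6
    rw [hu]
    simp only
    rw [div_le_iff₀ h4]
    norm_num at h1
    have h7 : 0 ≤ (c N : ℝ) * (Real.log N - 4 * D) := mul_nonneg (by positivity) (by linarith)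
    nlinarith
  obtain ⟨Bd, hBd⟩ := hub
  have hcN : Tendsto (fun N : ℕ => (c N : ℝ) / N) atTop (𝓝 0) := by
    refine squeeze_zero' (g := fun N : ℕ => Bd / Real.log N)
      (Eventually.of_forall fun N => by positivity) ?_
      (tendsto_const_nhds.div_atTop tendsto_log_natCast)
    filter_upwards [hBd, hlog_ge 1, hN1] with N h1 h2 h3
    rw [hu] at h1
    simp only at h1
    rw [le_div_iff₀ (by linarith), div_mul_eq_mul_div]
    exact h1
  -- ε Bd is the relative error on c_N ln N; in either direction at most four further errors of size
  -- ε remain.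
  have key : ∀ m : ℕ, ∀ᶠ N in atTop, |u N - h| ≤ 1 / ((m : ℝ) + 2) * (Bd + 4) := by
    intro m
    obtain ⟨D₁, hD₁⟩ := hU m
    obtain ⟨D₂, D₃, hD₂⟩ := hL m
    set ε : ℝ := 1 / ((m : ℝ) + 2) with hε
    have hε0 : 0 < ε := by positivity
    have hε1 : ε ≤ 1 := by
      rw [hε, div_le_one (by positivity)]
      linarith [(Nat.cast_nonneg m : (0 : ℝ) ≤ m)]
    have hsmall : ∀ D : ℝ, ∀ᶠ N : ℕ in atTop, D * ((c N : ℝ) / N) ≤ ε := fun D => by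
      have := hcN.const_mul D
      rw [mul_zero] at this
      exact this.eventually_le_const hε0
    filter_upwards [hD₁, hD₂, hBd, hu0, hN1, hs.eventually_le_const (lt_add_of_pos_right h hε0),
      hs.eventually_const_le (sub_lt_self h hε0), hsmall D₁, hsmall D₂, hlog_ge 0,
      tendsto_log_div_natCast.eventually_le_const hε0,
      tendsto_log_natCast.eventually (eventually_linear_le_exp (D₃ / ε) (D₃ / ε)
        (half_pos hε0))] with N h1 h2 h3 h4 h5 h6 h7 h8 h9 h10 h11 h12
    have huN : u N * N = c N * Real.log N := div_mul_cancel₀ _ h5.ne'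
    rw [div_le_iff₀ h5] at h6 h11
    rw [le_div_iff₀ h5] at h7
    rw [mul_div_assoc', div_le_iff₀ h5] at h8 h9
    have h13 : Real.exp ((1 - ε / 2) * Real.log N) * (D₃ * Real.log N + D₃) ≤ ε * N := by
      have h14 : D₃ * Real.log N + D₃ = ε * (D₃ / ε * Real.log N + D₃ / ε) := by
        field_simp
      have h15 : (N : ℝ) = Real.exp ((1 - ε / 2) * Real.log N) * Real.exp (ε / 2 * Real.log N) := by
        rw [← Real.exp_add, ← add_mul, sub_add_cancel, one_mul, Real.exp_log h5]
      rw [h14]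
      calc Real.exp ((1 - ε / 2) * Real.log N) * (ε * (D₃ / ε * Real.log N + D₃ / ε))
          ≤ Real.exp ((1 - ε / 2) * Real.log N) * (ε * Real.exp (ε / 2 * Real.log N)) := by gcongr
        _ = ε * (Real.exp ((1 - ε / 2) * Real.log N) * Real.exp (ε / 2 * Real.log N)) := by ring
        _ = ε * N := by rw [← h15]
    have h16 : ε * (u N * N) ≤ ε * (Bd * N) := by gcongr
    have h17 : 0 ≤ ε * Real.log N := by positivity
    rw [abs_le]
    constructor
    · refine le_of_mul_le_mul_right ?_ h5
      nlinarith
    · refine le_of_mul_le_mul_right ?_ h5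
      nlinarith
  have hulim : Tendsto u atTop (𝓝 h) := by
    refine Metric.tendsto_nhds.2 fun η hη => ?_
    have hBd4 : Tendsto (fun m : ℕ => 1 / ((m : ℝ) + 2) * (Bd + 4)) atTop (𝓝 0) := by
      have h1 : Tendsto (fun m : ℕ => (m : ℝ) + 2) atTop atTop :=
        tendsto_atTop_add_const_right _ _ tendsto_natCast_atTop_atTop
      have h2 := (tendsto_const_nhds (x := (1 : ℝ))).div_atTop h1
      simpa using h2.mul_const (Bd + 4)
    obtain ⟨m, hm⟩ := (hBd4.eventually_lt_const hη).exists
    filter_upwards [key m] with N hN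
    exact hN.trans_lt hm
  -- The estimator is u_N / (1 - c_N/N).
  have hlim := hulim.div ((tendsto_const_nhds (x := (1 : ℝ))).sub hcN) (by norm_num)
  rw [sub_zero, div_one] at hlim
  refine hlim.congr' ?_
  filter_upwards [hN1] with N hN
  simp only [hu, Pi.div_apply]
  rw [div_div, mul_sub, mul_one, mul_div_cancel₀ _ hN.ne']

/-! ### Convergence of the estimator -/

section Convergence

variable {A : Type*} [MeasurableSpace A] {P : Measure (ℕ → A)}

/-- Convergence of the estimator for a pair `(x, y)` of sequences: the potential `ψ` describes the
probabilities of the words of `y`, the matches are at most logarithmically long, likely words occur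
in `x`, and few positions of `y` start unlikely words which occur in `x`. -/
lemma tendsto_estimator {ψ : (ℕ → A) → ℝ} {M : ℝ} (hM : ∀ z, |ψ z| ≤ M) {κ : ℕ → ℝ}
    (hκ : κ =o[atTop] fun n : ℕ => (n : ℝ)) {x y : ℕ → A}
    (hψ : ∀ k n : ℕ, 1 ≤ n → 0 < P.real (cyl (word (shift^[k] y) n)) ∧
      P.real (cyl (word (shift^[k] y) n)) ≤ 1 ∧
      |birkhoffSum shift ψ n (shift^[k] y) + Real.log (P.real (cyl (word (shift^[k] y) n)))| ≤ κ n)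
    {h : ℝ} (hs : Tendsto (fun N : ℕ => birkhoffSum shift ψ N y / N) atTop (𝓝 h))
    {C : ℝ} (hC : 0 < C)
    (hlong : ∀ᶠ N : ℕ in atTop, ∀ k < N, ¬ Occurs N x (shift^[k] y) ⌈C * Real.log N⌉₊)
    (hlikely : ∀ m : ℕ, ∀ᶠ N : ℕ in atTop, ∀ k < N, ∀ n, 1 ≤ n → n ≤ ⌈C * Real.log N⌉₊ + 1 →
      Real.exp (-(1 - 1 / ((m : ℝ) + 2)) * Real.log N) ≤ P.real (cyl (word (shift^[k] y) n)) →
      Occurs N x (shift^[k] y) n)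
    (hunlikely : ∀ m : ℕ, ∀ᶠ N : ℕ in atTop, ∃ B : Finset ℕ,
      (B.card : ℝ) ≤ Real.exp ((1 - 1 / ((m : ℝ) + 2) / 2) * Real.log N) ∧
      ∀ k < N, k ∉ B → ∀ n, Occurs N x (shift^[k] y) n →
        Real.exp (-(1 + 1 / ((m : ℝ) + 2)) * Real.log N) ≤
          P.real (cyl (word (shift^[k] y) n))) :
    Tendsto (fun N : ℕ => estimator N y x) atTop (𝓝 h) := by
  have hM0 : 0 ≤ M := (abs_nonneg _).trans (hM y)
  have hmatch : ∀ᶠ N : ℕ in atTop, ∀ k < N,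
      matchLength N (shift^[k] y) x ≤ ⌈C * Real.log N⌉₊ := by
    filter_upwards [hlong, tendsto_log_natCast.eventually_gt_atTop 0] with N h1 h2 k hk
    exact matchLength_le_of_not_occurs (Nat.one_le_ceil_iff.2 (by positivity)) (h1 k hk)
  refine tendsto_estimator_of_bounds (c := fun N => wordCount N y x) hs (fun m => ?_) fun m => ?_
  · obtain ⟨D, hD0, hD⟩ := exists_le_linear hκ (δ := 1 / ((m : ℝ) + 2)) (by positivity)
    refine ⟨D, ?_⟩
    filter_upwards [hlikely m, hmatch, tendsto_log_natCast.eventually_ge_atTop 0] with N h1 h2 h3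
    have hε : 1 / ((m : ℝ) + 2) ≤ 1 := by
      rw [div_le_one (by positivity)]
      linarith [(Nat.cast_nonneg m : (0 : ℝ) ≤ m)]
    refine wordCount_mul_le (mul_nonneg (by linarith) h3) (fun k _ n hn => ?_) fun k hk => ?_
    · obtain ⟨hpos, hle, habs⟩ := hψ k n hn
      have h4 := Real.log_nonpos hpos.le hle
      linarith [(abs_le.1 habs).1, hD n]
    · set n := matchLength N (shift^[k] y) x + 1 with hn
      have hn1 : 1 ≤ n := by omega
      obtain ⟨hpos, hle, habs⟩ := hψ k n hn1
      have hlt : P.real (cyl (word (shift^[k] y) n)) <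
          Real.exp (-(1 - 1 / ((m : ℝ) + 2)) * Real.log N) := by
        by_contra hge
        exact not_occurs_matchLength_succ N _ x
          (h1 k hk n hn1 (by have := h2 k hk; omega) (not_lt.1 hge))
      have h4 := Real.log_le_log hpos hlt.le
      rw [Real.log_exp] at h4
      linarith [(abs_le.1 habs).1, hD n]
  · obtain ⟨D, hD0, hD⟩ := exists_le_linear hκ (δ := 1 / ((m : ℝ) + 2)) (by positivity)
    -- 2M covers a word built on a default match (at most two symbols) as well as the symbol
    -- appended to a genuine match. The other constant comes from |S_nψ| ≤ nM with n ≤ C ln N + 2.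
    refine ⟨D + 2 * M, max (M * C) (2 * M), ?_⟩
    filter_upwards [hunlikely m, hmatch, tendsto_log_natCast.eventually_ge_atTop 0]
      with N ⟨B, hB, h1⟩ h2 h3
    have hε0 : 0 < 1 / ((m : ℝ) + 2) := by positivity
    set ε := 1 / ((m : ℝ) + 2) with hε
    set D' := max (M * C) (2 * M) with hD'
    have hD'0 : 0 ≤ D' := le_max_of_le_right (by positivity)
    have hbirk := fun n k => (abs_le.1 (abs_birkhoffSum_le (T := shift) hM n (shift^[k] y)))
    refine (birkhoffSum_le_wordCount_mul (x := x) (b := (1 + ε) * Real.log N + (D + 2 * M))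
      (b' := D' * Real.log N + D') (δ := ε)
      (by positivity) (by positivity) B (fun k hk n _ hn => ?_) fun k hk hkB n hn1 hn => ?_).trans ?_
    · have h4 : (n : ℝ) ≤ C * Real.log N + 2 := by
        have h5 : (n : ℝ) ≤ (⌈C * Real.log N⌉₊ : ℝ) + 1 := by
          exact_mod_cast hn.trans (Nat.add_le_add_right (h2 k hk) 1)
        linarith [Nat.ceil_lt_add_one (show 0 ≤ C * Real.log N by positivity)]
      calc birkhoffSum shift ψ n (shift^[k] y) ≤ n * M := (hbirk n k).2
        _ ≤ (C * Real.log N + 2) * M := by gcongr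
        _ = M * C * Real.log N + 2 * M := by ring
        _ ≤ D' * Real.log N + D' := by
            gcongr
            · exact le_max_left _ _
            · exact le_max_right _ _
        _ ≤ D' * Real.log N + D' + ε * n := le_add_of_nonneg_right (by positivity)
    · rcases matchLength_eq_one_or_occurs N (shift^[k] y) x with h4 | h4
      · have h5 : (n : ℝ) ≤ 2 := by
          rw [h4] at hn
          exact_mod_cast hn
        calc birkhoffSum shift ψ n (shift^[k] y) ≤ n * M := (hbirk n k).2
          _ ≤ 2 * M := by gcongr
          _ ≤ (1 + ε) * Real.log N + (D + 2 * M) + ε * n := by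
              have : 0 ≤ (1 + ε) * Real.log N := by positivity
              have : 0 ≤ ε * n := by positivity
              linarith
      · have hbound : ∀ l, 1 ≤ l → l ≤ matchLength N (shift^[k] y) x →
            birkhoffSum shift ψ l (shift^[k] y) ≤ (1 + ε) * Real.log N + D + ε * l := by
          intro l hl1 hl
          obtain ⟨hpos, -, habs⟩ := hψ k l hl1
          have h5 := Real.log_le_log (Real.exp_pos _) (h1 k hk hkB l (h4.mono le_rfl hl))
          rw [Real.log_exp] at h5
          linarith [(abs_le.1 habs).2, hD l]
        rcases hn.lt_or_eq with hlt | heq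
        · linarith [hbound n hn1 (by omega)]
        -- The full word does not occur, so the bound is applied to the match and the last symbol is
        -- paid for by M.
        · have hl1 := one_le_matchLength N (shift^[k] y) x
          have h5 := hbound _ hl1 le_rfl
          rw [heq, birkhoffSum_succ]
          push_cast
          linarith [(abs_le.1 (hM (shift^[matchLength N (shift^[k] y) x] (shift^[k] y)))).2]
    · gcongr

variable {Q : Measure (ℕ → A)} [Fintype A] [MeasurableSingletonClass A] [IsProbabilityMeasure P]
  [IsProbabilityMeasure Q]

/-- By Fubini, y may be frozen first: Birkhoff's theorem concerns y alone, and the two occurrence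
estimates hold for P-almost every x once y is given. Only the logarithmic bound on matches uses the
joint law. -/
lemma ae_tendsto_estimator (hP : MeasurePreserving shift P P) (hQ : Ergodic shift Q)
    (hPSLD : SelectivelyLowerDecoupled P) (hND : Nondegenerate P Q)
    {Ω : Set (ℕ → A)} (hmaps : Set.MapsTo shift Ω Ω) (hQΩ : ∀ᵐ y ∂Q, y ∈ Ω)
    {ψ : (ℕ → A) → ℝ} (hψ : Measurable ψ) {M : ℝ} (hM : ∀ z, |ψ z| ≤ M) {κ : ℕ → ℝ}
    (hκ : κ =o[atTop] fun n : ℕ => (n : ℝ))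
    (hG : ∀ n : ℕ, 1 ≤ n → ∀ y ∈ Ω, 0 < P.real (cyl (word y n)) ∧
      |birkhoffSum shift ψ n y + Real.log (P.real (cyl (word y n)))| ≤ κ n) :
    ∀ᵐ xy ∂(P.prod Q),
      Tendsto (fun N : ℕ => estimator N xy.2 xy.1) atTop (𝓝 (∫ y, ψ y ∂Q)) := by
  obtain ⟨C, hC, hlong⟩ := hND.ae_eventually_not_occurs hP hQ.toMeasurePreserving
  have hmeas : MeasurableSet {xy : (ℕ → A) × (ℕ → A) |
      Tendsto (fun N : ℕ => estimator N xy.2 xy.1) atTop (𝓝 (∫ y, ψ y ∂Q))} :=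
    measurableSet_tendsto _ measurable_estimator
  rw [← Measure.prod_swap (μ := Q) (ν := P)] at hlong ⊢
  refine (ae_map_iff measurable_swap.aemeasurable hmeas).2
    ((Measure.ae_prod_iff_ae_ae (measurable_swap hmeas)).2 ?_)
  filter_upwards [Measure.ae_ae_of_ae_prod (ae_of_ae_map measurable_swap.aemeasurable hlong), hQΩ,
    ae_tendsto_birkhoffSum_div hQ hψ hM] with y hlong hy hbirk
  have hyΩ : ∀ k, shift^[k] y ∈ Ω := fun k => hmaps.iterate k hy
  have hysupp : ∀ k n, word (shift^[k] y) n ∈ suppWords P n := by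
    intro k n
    rcases Nat.eq_zero_or_pos n with rfl | hn
    · have huniv : cyl (word (shift^[k] y) 0) = Set.univ :=
        Set.eq_univ_of_forall fun x => Subsingleton.elim (α := Fin 0 → A) _ _
      simp [suppWords, huniv]
    · exact (ENNReal.toReal_pos_iff.1 (hG n hn _ (hyΩ k)).1).1
  have hε : ∀ m : ℕ, 0 < 1 / ((m : ℝ) + 2) ∧ 1 / ((m : ℝ) + 2) ≤ 1 := fun m =>
    ⟨by positivity, by
      rw [div_le_one (by positivity)]
      linarith [(Nat.cast_nonneg m : (0 : ℝ) ≤ m)]⟩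
  filter_upwards [hlong,
    ae_all_iff.2 fun m => hPSLD.ae_eventually_occurs hP hysupp hC (hε m).1 (hε m).2,
    ae_all_iff.2 fun m => ae_eventually_exists_exceptional hP y (hε m).1 (hε m).2]
    with x hlong hlikely hunlikely
  exact tendsto_estimator hM hκ
    (fun k n hn => ⟨(hG n hn _ (hyΩ k)).1, measureReal_le_one, (hG n hn _ (hyΩ k)).2⟩)
    hbirk hC hlong hlikely hunlikely

end Convergence

end ZivMerhav

end

theorem corollary4p4 {A : Type*} [Fintype A]
    [TopologicalSpace A] [DiscreteTopology A] [MeasurableSpace A] [MeasurableSingletonClass A]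
    (P Q : Measure (ℕ → A)) [IsProbabilityMeasure P] [IsProbabilityMeasure Q]
    (hP : MeasurePreserving ZivMerhav.shift P P)
    (hQ : Ergodic ZivMerhav.shift Q)
    (hPSLD : ZivMerhav.SelectivelyLowerDecoupled P)
    (hPUD : ZivMerhav.UpperDecoupled P)
    (hPSE : ZivMerhav.DecaysSlowlyEnough P)
    (hQUD : ZivMerhav.UpperDecoupled Q)
    (hND : ZivMerhav.Nondegenerate P Q)
    (hsupp : ZivMerhav.suppSeq Q ⊆ ZivMerhav.suppSeq P)
    (hWG : ZivMerhav.WeakGibbs P) :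
    ∃ h : ℝ, ZivMerhav.IsCrossEntropy Q P h ∧
      ∀ᵐ xy ∂(P.prod Q),
        Tendsto (fun N : ℕ => ZivMerhav.estimator N xy.2 xy.1) atTop (𝓝 h) := by
  obtain ⟨Ω, ψ, M, κ, hmaps, hsub, hψ, hM, hκ, hG⟩ := hWG.exists_potential
  -- The inclusion of supports carries the Gibbs estimate for P over to Q-typical sequences,
  -- although Ω is only assumed to carry P.
  have hQΩ : ∀ᵐ y ∂Q, y ∈ Ω := (ZivMerhav.ae_mem_suppSeq Q).mono fun y hy => hsub (hsupp hy)
  exact ⟨∫ y, ψ y ∂Q, ZivMerhav.isCrossEntropy_of_potential hQ.toMeasurePreserving hψ hM hκ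
    fun n hn => hQΩ.mono fun y hy => (hG n hn y hy).2,
    ZivMerhav.ae_tendsto_estimator hP hQ hPSLD hND hmaps hQΩ hψ hM hκ hG⟩
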